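/- **Theorem (Cartier duality).** Let $R$ be a commutative ring. All functors are covariant functors on the category of commutative $R$-algebras, and $\mathcal R$ is the functor $\mathcal R(S)=S$. For a functor $\mathbb X$ and a commutative $R$-algebra $S$, $\mathbb X_{|S}$ is its restriction to commutative $S$-algebras. A *functor of $\mathcal R$-modules* $\mathbb M$ is a functor of sets with functorial $S$-module structures on the sets $\mathbb M(S)$; its dual is $\mathbb M^*=\mathbb Hom_{\mathcal R}(\mathbb M,\mathcal R)$, $\mathbb M^*(S)=\mathrm{Hom}_{\mathcal S}(\mathbb M_{|S},\mathcal S)$, and $\mathbb M$ is *reflexive* if the natural morphism $\mathbb M\to\mathbb M^{**}$ is an isomorphism. An $R$-module $C$ defines the functor of $\mathcal R$-modules $\mathcal C(S)=C\otimes_R S$. A *functor of $\mathcal R$-algebras* $\mathbb A$ is a functor of $\mathcal R$-modules with functorial associative unital $S$-algebra structures on the modules $\mathbb A(S)$; put $(\mathrm{Spec}\,\mathbb A)(S)=\mathrm{Hom}_{\mathcal S\text{-alg}}(\mathbb A_{|S},\mathcal S)$. The functor of functions of a functor of sets $\mathbb X$ is $\mathbb A_{\mathbb X}=\mathbb Hom(\mathbb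 X,\mathcal R)$, $\mathbb A_{\mathbb X}(S)=\mathrm{Hom}(\mathbb X_{|S},\mathcal S)$. The dual of a functor of abelian monoids $\mathbb G$ is the functor of abelian monoids $\mathbb G^\vee=\mathbb Hom_{mon}(\mathbb G,\mathcal R)$, $\mathbb G^\vee(S)=\mathrm{Hom}_{mon}(\mathbb G_{|S},\mathcal S)$, where $\mathcal S$ is a monoid under multiplication. Let $\mathsf{Aff}$ be the category of abelian affine $R$-monoid schemes $\mathrm{Spec}\,A$ with $A$ free as an $R$-module, that is, the functors of abelian monoids whose underlying functor of sets is isomorphic to $S\mapsto\mathrm{Hom}_{R\text{-alg}}(A,S)$ for some commutative $R$-algebra $A$ that is a free $R$-module. Let $\mathsf{For}$ be the category of abelian formal monoids, that is, the functors of abelian monoids whose underlying functor of sets is isomorphic to $\mathrm{Spec}\,\mathcal C^*$ for some free $R$-module $C$ and some structure of functor of commutative $\mathcal R$-algebras on $\mathcal C^*$. Morphisms in both categories are the morphisms of functors of monoids. Then: 1. $\mathbb G\mapsto\mathbb G^\vee$ maps $\mathsf{Aff}$ to $\mathsf{For}$ and $\mathsf{For}$ to $\mathsf{Aff}$, and both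 contravariant functors $\mathsf{Aff}\to\mathsf{For}$ and $\mathsf{For}\to\mathsf{Aff}$ so obtained are anti-equivalences of categories. 2. If $\mathbb G$ is in $\mathsf{Aff}$ or in $\mathsf{For}$, then $\mathbb A_{\mathbb G}$ is reflexive. For every functor of abelian monoids $\mathbb G$ such that $\mathbb A_{\mathbb G}$ is reflexive, there is a unique structure of functor of $\mathcal R$-algebras on $\mathbb A_{\mathbb G}^*$ for which the natural morphism $\mathbb G\to\mathbb A_{\mathbb G}^*$, $g\mapsto(f\mapsto f(g))$, is a morphism of functors of monoids; this structure is commutative, and composition with $\mathbb G\to\mathbb A_{\mathbb G}^*$ is an isomorphism $\mathrm{Spec}\,\mathbb A_{\mathbb G}^*\simeq\mathbb G^\vee$ of functors of sets. -/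

import Mathlib

universe w u

open CategoryTheory Opposite
open scoped TensorProduct

noncomputable section

namespace CartierDuality

/-- A functor of `𝓡`-modules: a covariant functor `S ↦ 𝕄(S)` on commutative `R`-algebras, where
`𝕄(S)` is an `S`-module and the addition and the action of `𝓡(S) = S` are functorial in `S`. -/
structure ModuleFunctor (R : Type u) [CommRing R] where
  obj : CommAlgCat.{u} R → Type w
  [addCommGroup : ∀ S, AddCommGroup (obj S)]
  [module : ∀ S : CommAlgCat.{u} R, Module S (obj S)]
  map : ∀ {S T : CommAlgCat.{u} R}, (S ⟶ T) → (obj S →+ obj T)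
  map_smul : ∀ {S T : CommAlgCat.{u} R} (f : S ⟶ T) (s : S) (x : obj S),
    map f (s • x) = f s • map f x
  map_id : ∀ (S : CommAlgCat.{u} R) (x : obj S), map (𝟙 S) x = x
  map_comp : ∀ {S T U : CommAlgCat.{u} R} (f : S ⟶ T) (g : T ⟶ U) (x : obj S),
    map (f ≫ g) x = map g (map f x)

attribute [instance] ModuleFunctor.addCommGroup ModuleFunctor.module

variable {R : Type u} [CommRing R]

/-- The quasi-coherent module `𝓜(S) = S ⊗_R M` of an `R`-module `M`. -/
abbrev quasiCoherent (R : Type u) [CommRing R] (M : Type u) [AddCommGroup M] [Module R M] :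
    ModuleFunctor.{u, u} R where
  obj S := S ⊗[R] M
  map f := (LinearMap.rTensor M f.hom.toLinearMap).toAddMonoidHom
  map_smul f s x := by
    induction x with
    | zero => simp
    | tmul a m => simp [TensorProduct.smul_tmul']
    | add x y hx hy =>
      rw [smul_add, map_add, hx, hy, map_add, smul_add]
  map_id S x := by
    simp
  map_comp f g x := by
    simp [LinearMap.rTensor_comp]

/-! ### Dual functors of modules -/

/-- An element of `𝕄^*(S) = Hom_𝓢(𝕄_{|S}, 𝓢)`. A commutative `S`-algebra is encoded as a
commutative `R`-algebra `T` with a morphism `φ : S ⟶ T` of `R`-algebras. -/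
@[ext]
structure DualAt (M : ModuleFunctor.{w} R) (S : CommAlgCat.{u} R) where
  app : ∀ {T : CommAlgCat.{u} R}, (S ⟶ T) → (M.obj T →ₗ[T] T)
  naturality : ∀ {T T' : CommAlgCat.{u} R} (φ : S ⟶ T) (ψ : T ⟶ T') (x : M.obj T),
    app (φ ≫ ψ) (M.map ψ x) = ψ (app φ x)

namespace DualAt

variable {M : ModuleFunctor.{w} R} {S : CommAlgCat.{u} R}

instance : Zero (DualAt M S) := ⟨⟨fun _ => 0, by simp⟩⟩
instance : Add (DualAt M S) :=
  ⟨fun a b => ⟨fun φ => a.app φ + b.app φ, by simp [naturality]⟩⟩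
instance : Neg (DualAt M S) :=
  ⟨fun a => ⟨fun φ => - a.app φ, by simp [naturality]⟩⟩
/-- Scalars of `S` act on the value at `φ : S ⟶ T` through `φ`. -/
instance : SMul S (DualAt M S) :=
  ⟨fun s a => ⟨fun φ => φ s • a.app φ, by simp [naturality]⟩⟩

lemma zero_app {T : CommAlgCat.{u} R} (φ : S ⟶ T) : (0 : DualAt M S).app φ = 0 := rfl
lemma add_app (a b : DualAt M S) {T : CommAlgCat.{u} R} (φ : S ⟶ T) :
    (a + b).app φ = a.app φ + b.app φ := rfl
lemma neg_app (a : DualAt M S) {T : CommAlgCat.{u} R} (φ : S ⟶ T) :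
    (-a).app φ = -a.app φ := rfl
lemma smul_app (s : S) (a : DualAt M S) {T : CommAlgCat.{u} R} (φ : S ⟶ T) :
    (s • a).app φ = φ s • a.app φ := rfl

lemma ext_app {a b : DualAt M S}
    (h : ∀ {T : CommAlgCat.{u} R} (φ : S ⟶ T), a.app φ = b.app φ) : a = b :=
  DualAt.ext (by funext T φ; exact h φ)

instance : AddCommGroup (DualAt M S) where
  add_assoc a b c := ext_app fun φ => by simp only [add_app, add_assoc]
  zero_add a := ext_app fun φ => by simp only [add_app, zero_app, zero_add]
  add_zero a := ext_app fun φ => by simp only [add_app, zero_app, add_zero]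
  add_comm a b := ext_app fun φ => by simp only [add_app, add_comm]
  neg_add_cancel a := ext_app fun φ => by
    simp only [add_app, neg_app, zero_app, neg_add_cancel]
  nsmul := nsmulRec
  zsmul := zsmulRec

instance : Module S (DualAt M S) where
  one_smul a := ext_app fun φ => by simp only [smul_app, map_one, one_smul]
  mul_smul s t a := ext_app fun φ => by simp only [smul_app, map_mul, mul_smul]
  smul_zero s := ext_app fun φ => by simp only [smul_app, zero_app, smul_zero]
  smul_add s a b := ext_app fun φ => by simp only [smul_app, add_app, smul_add]
  add_smul s t a := ext_app fun φ => by simp only [smul_app, add_app, map_add, add_smul]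
  zero_smul a := ext_app fun φ => by simp only [smul_app, zero_app, map_zero, zero_smul]

end DualAt

/-- The dual functor `𝕄^* = ℍom_𝓡(𝕄, 𝓡)`. -/
abbrev ModuleFunctor.dual (M : ModuleFunctor.{w} R) : ModuleFunctor.{max w (u + 1)} R where
  obj S := DualAt M S
  map f :=
    { toFun := fun a => ⟨fun φ => a.app (f ≫ φ), fun φ ψ x => by
        rw [← Category.assoc]; exact a.naturality _ _ _⟩
      map_zero' := rfl
      map_add' := fun _ _ => rfl }
  map_smul f s a := DualAt.ext_app fun φ => by
    change (f ≫ φ) s • a.app (f ≫ φ) = φ (f s) • a.app (f ≫ φ)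
    rw [CommAlgCat.comp_apply]
  map_id S a := DualAt.ext_app fun φ => by
    change a.app (𝟙 S ≫ φ) = a.app φ
    rw [Category.id_comp]
  map_comp f g a := DualAt.ext_app fun φ => by
    change a.app ((f ≫ g) ≫ φ) = a.app (f ≫ g ≫ φ)
    rw [Category.assoc]

/-- The natural morphism `𝕄 → 𝕄^{**}`, `m ↦ (w ↦ w(m))`. -/
def ModuleFunctor.toBidual (M : ModuleFunctor.{w} R) (S : CommAlgCat.{u} R) (m : M.obj S) :
    M.dual.dual.obj S where
  app {T} φ :=
    { toFun := fun (a : DualAt M T) => a.app (𝟙 T) (M.map φ m)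
      map_add' := fun a b => by rw [DualAt.add_app, LinearMap.add_apply]
      map_smul' := fun t a => by
        rw [DualAt.smul_app, LinearMap.smul_apply, CommAlgCat.id_apply]; rfl }
  naturality {T T'} φ ψ (a : DualAt M T) := by
    change a.app (ψ ≫ 𝟙 T') (M.map (φ ≫ ψ) m) = ψ (a.app (𝟙 T) (M.map φ m))
    rw [M.map_comp, ← a.naturality (𝟙 T) ψ, Category.comp_id, Category.id_comp]

/-- `𝕄` is reflexive if the natural morphism `𝕄 → 𝕄^{**}` is an isomorphism. -/
def ModuleFunctor.IsReflexive (M : ModuleFunctor.{w} R) : Prop :=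
  ∀ S : CommAlgCat.{u} R, Function.Bijective (M.toBidual S)

/-! ### Functors of algebras and their spectra -/

/-- A structure of functor of (associative, unital) `𝓡`-algebras on a functor of modules. -/
@[ext]
structure AlgebraStructure (M : ModuleFunctor.{w} R) where
  mul : ∀ S : CommAlgCat.{u} R, M.obj S →ₗ[S] M.obj S →ₗ[S] M.obj S
  one : ∀ S : CommAlgCat.{u} R, M.obj S
  mul_assoc : ∀ S (x y z : M.obj S), mul S (mul S x y) z = mul S x (mul S y z)
  one_mul : ∀ S (x : M.obj S), mul S (one S) x = x
  mul_one : ∀ S (x : M.obj S), mul S x (one S) = x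
  map_mul : ∀ {S T : CommAlgCat.{u} R} (f : S ⟶ T) (x y : M.obj S),
    M.map f (mul S x y) = mul T (M.map f x) (M.map f y)
  map_one : ∀ {S T : CommAlgCat.{u} R} (f : S ⟶ T), M.map f (one S) = one T

/-- The functor of algebras is commutative. -/
def AlgebraStructure.IsComm {M : ModuleFunctor.{w} R} (A : AlgebraStructure M) : Prop :=
  ∀ (S : CommAlgCat.{u} R) (x y : M.obj S), A.mul S x y = A.mul S y x

/-- A point of `(Spec 𝔸)(S) = Hom_{𝓢-alg}(𝔸_{|S}, 𝓢)`: a linear map `𝔸_{|S} → 𝓢` that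
preserves products and units. -/
@[ext]
structure AlgebraStructure.SpecAt {M : ModuleFunctor.{w} R} (A : AlgebraStructure M)
    (S : CommAlgCat.{u} R) where
  toDual : DualAt M S
  map_mul : ∀ {T : CommAlgCat.{u} R} (φ : S ⟶ T) (x y : M.obj T),
    toDual.app φ (A.mul T x y) = toDual.app φ x * toDual.app φ y
  map_one : ∀ {T : CommAlgCat.{u} R} (φ : S ⟶ T), toDual.app φ (A.one T) = 1

/-- The functor of sets `Spec 𝔸 = ℍom_{𝓡-alg}(𝔸, 𝓡)`. -/
def AlgebraStructure.spec {M : ModuleFunctor.{w} R} (A : AlgebraStructure M) :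
    CommAlgCat.{u} R ⥤ Type (max w (u + 1)) where
  obj S := A.SpecAt S
  map f := ↾fun h => ⟨M.dual.map f h.toDual, fun φ => h.map_mul (f ≫ φ),
    fun φ => h.map_one (f ≫ φ)⟩
  map_id S := by
    refine ConcreteCategory.hom_ext _ _ fun (h : A.SpecAt S) => ?_
    exact SpecAt.ext (M.dual.map_id S h.toDual)
  map_comp {S T U} f g := by
    refine ConcreteCategory.hom_ext _ _ fun (h : A.SpecAt S) => ?_
    exact SpecAt.ext (M.dual.map_comp f g h.toDual)

/-! ### The functor of functions -/

/-- An element of `𝔸_𝕏(S) = Hom(𝕏_{|S}, 𝓢)`. -/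
@[ext]
structure FunctionAt (X : CommAlgCat.{u} R ⥤ Type w) (S : CommAlgCat.{u} R) where
  app : ∀ {T : CommAlgCat.{u} R}, (S ⟶ T) → X.obj T → T
  naturality : ∀ {T T' : CommAlgCat.{u} R} (φ : S ⟶ T) (ψ : T ⟶ T') (x : X.obj T),
    app (φ ≫ ψ) (X.map ψ x) = ψ (app φ x)

namespace FunctionAt

variable {X : CommAlgCat.{u} R ⥤ Type w} {S : CommAlgCat.{u} R}

instance : Zero (FunctionAt X S) := ⟨⟨fun _ _ => 0, by simp⟩⟩
instance : Add (FunctionAt X S) :=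
  ⟨fun a b => ⟨fun φ x => a.app φ x + b.app φ x, by simp [naturality]⟩⟩
instance : Neg (FunctionAt X S) :=
  ⟨fun a => ⟨fun φ x => - a.app φ x, by simp [naturality]⟩⟩
instance : SMul S (FunctionAt X S) :=
  ⟨fun s a => ⟨fun φ x => φ s * a.app φ x, by simp [naturality]⟩⟩

lemma zero_app {T : CommAlgCat.{u} R} (φ : S ⟶ T) (x : X.obj T) :
    (0 : FunctionAt X S).app φ x = 0 := rfl
lemma add_app (a b : FunctionAt X S) {T : CommAlgCat.{u} R} (φ : S ⟶ T) (x : X.obj T) :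
    (a + b).app φ x = a.app φ x + b.app φ x := rfl
lemma neg_app (a : FunctionAt X S) {T : CommAlgCat.{u} R} (φ : S ⟶ T) (x : X.obj T) :
    (-a).app φ x = -a.app φ x := rfl
lemma smul_app (s : S) (a : FunctionAt X S) {T : CommAlgCat.{u} R} (φ : S ⟶ T) (x : X.obj T) :
    (s • a).app φ x = φ s * a.app φ x := rfl

lemma ext_app {a b : FunctionAt X S}
    (h : ∀ {T : CommAlgCat.{u} R} (φ : S ⟶ T) (x : X.obj T), a.app φ x = b.app φ x) : a = b :=
  FunctionAt.ext (by funext T φ x; exact h φ x)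

instance : AddCommGroup (FunctionAt X S) where
  add_assoc a b c := ext_app fun φ x => by simp only [add_app, add_assoc]
  zero_add a := ext_app fun φ x => by simp only [add_app, zero_app, zero_add]
  add_zero a := ext_app fun φ x => by simp only [add_app, zero_app, add_zero]
  add_comm a b := ext_app fun φ x => by simp only [add_app, add_comm]
  neg_add_cancel a := ext_app fun φ x => by
    simp only [add_app, neg_app, zero_app, neg_add_cancel]
  nsmul := nsmulRec
  zsmul := zsmulRec

instance : Module S (FunctionAt X S) where
  one_smul a := ext_app fun φ x => by simp only [smul_app, map_one, one_mul]
  mul_smul s t a := ext_app fun φ x => by simp only [smul_app, map_mul, mul_assoc]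
  smul_zero s := ext_app fun φ x => by simp only [smul_app, zero_app, mul_zero]
  smul_add s a b := ext_app fun φ x => by simp only [smul_app, add_app, mul_add]
  add_smul s t a := ext_app fun φ x => by simp only [smul_app, add_app, map_add, add_mul]
  zero_smul a := ext_app fun φ x => by simp only [smul_app, zero_app, map_zero, zero_mul]

end FunctionAt

/-- The functor of functions `𝔸_𝕏 = ℍom(𝕏, 𝓡)`, as a functor of `𝓡`-modules. -/
abbrev functions (X : CommAlgCat.{u} R ⥤ Type w) : ModuleFunctor.{max w (u + 1)} R where
  obj S := FunctionAt X S
  map f :=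
    { toFun := fun a => ⟨fun φ x => a.app (f ≫ φ) x, fun φ ψ x => by
        rw [← Category.assoc]; exact a.naturality _ _ _⟩
      map_zero' := rfl
      map_add' := fun _ _ => rfl }
  map_smul f s a := FunctionAt.ext_app fun φ x => by
    change (f ≫ φ) s * a.app (f ≫ φ) x = φ (f s) * a.app (f ≫ φ) x
    rw [CommAlgCat.comp_apply]
  map_id S a := FunctionAt.ext_app fun φ x => by
    change a.app (𝟙 S ≫ φ) x = a.app φ x
    rw [Category.id_comp]
  map_comp f g a := FunctionAt.ext_app fun φ x => by
    change a.app ((f ≫ g) ≫ φ) x = a.app (f ≫ g ≫ φ) x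
    rw [Category.assoc]

/-- The natural morphism `𝕏 → 𝔸_𝕏^*`, `x ↦ (f ↦ f(x))`. -/
def evalMap (X : CommAlgCat.{u} R ⥤ Type w) (S : CommAlgCat.{u} R) (x : X.obj S) :
    (functions X).dual.obj S where
  app {T} φ :=
    { toFun := fun (f : FunctionAt X T) => f.app (𝟙 T) (X.map φ x)
      map_add' := fun _ _ => rfl
      map_smul' := fun t f => by
        rw [FunctionAt.smul_app, CommAlgCat.id_apply]; rfl }
  naturality {T T'} φ ψ (f : FunctionAt X T) := by
    change f.app (ψ ≫ 𝟙 T') (X.map (φ ≫ ψ) x) = ψ (f.app (𝟙 T) (X.map φ x))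
    rw [← f.naturality (𝟙 T) ψ, Category.comp_id, Category.id_comp, Functor.map_comp]
    rfl

/-! ### Functors of abelian monoids and the dual monoid -/

/-- Functors of abelian monoids on commutative `R`-algebras; the values lie in the universe
`u + 1`, which is closed under all `ℍom` constructions. -/
abbrev CommMonFunctor (R : Type u) [CommRing R] := CommAlgCat.{u} R ⥤ CommMonCat.{u + 1}

/-- The underlying functor of sets. -/
abbrev CommMonFunctor.toSet (G : CommMonFunctor R) : CommAlgCat.{u} R ⥤ Type (u + 1) :=
  G ⋙ forget CommMonCat

/-- An element of `𝔾^∨(S) = Hom_mon(𝔾_{|S}, 𝓢)`, where `𝓢` is a monoid under multiplication. -/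
@[ext]
structure CharacterAt (G : CommMonFunctor R) (S : CommAlgCat.{u} R) where
  app : ∀ {T : CommAlgCat.{u} R}, (S ⟶ T) → (G.obj T →* T)
  naturality : ∀ {T T' : CommAlgCat.{u} R} (φ : S ⟶ T) (ψ : T ⟶ T') (x : G.obj T),
    app (φ ≫ ψ) (G.map ψ x) = ψ (app φ x)

namespace CharacterAt

variable {G : CommMonFunctor R} {S : CommAlgCat.{u} R}

instance : One (CharacterAt G S) := ⟨⟨fun _ => 1, by simp⟩⟩
instance : Mul (CharacterAt G S) :=
  ⟨fun a b => ⟨fun φ => a.app φ * b.app φ, by simp [naturality]⟩⟩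

lemma one_app {T : CommAlgCat.{u} R} (φ : S ⟶ T) : (1 : CharacterAt G S).app φ = 1 := rfl
lemma mul_app (a b : CharacterAt G S) {T : CommAlgCat.{u} R} (φ : S ⟶ T) :
    (a * b).app φ = a.app φ * b.app φ := rfl

lemma ext_app {a b : CharacterAt G S}
    (h : ∀ {T : CommAlgCat.{u} R} (φ : S ⟶ T), a.app φ = b.app φ) : a = b :=
  CharacterAt.ext (by funext T φ; exact h φ)

instance : CommMonoid (CharacterAt G S) where
  mul_assoc a b c := ext_app fun φ => by simp only [mul_app, mul_assoc]
  one_mul a := ext_app fun φ => by simp only [mul_app, one_app, one_mul]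
  mul_one a := ext_app fun φ => by simp only [mul_app, one_app, mul_one]
  mul_comm a b := ext_app fun φ => by simp only [mul_app, mul_comm]

/-- Restriction of characters along `f : S ⟶ T`. -/
def restrict {S T : CommAlgCat.{u} R} (f : S ⟶ T) : CharacterAt G S →* CharacterAt G T where
  toFun a := ⟨fun φ => a.app (f ≫ φ), fun φ ψ x => by
    rw [← Category.assoc]; exact a.naturality _ _ _⟩
  map_one' := rfl
  map_mul' _ _ := rfl

/-- Composition of characters with a morphism `h : G ⟶ H`. -/
def pullback {G H : CommMonFunctor R} (h : G ⟶ H) (S : CommAlgCat.{u} R) :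
    CharacterAt H S →* CharacterAt G S where
  toFun a := ⟨fun {T} φ => (a.app φ).comp (h.app T).hom, fun {T T'} φ ψ x => by
    change a.app (φ ≫ ψ) (h.app T' (G.map ψ x)) = ψ (a.app φ (h.app T x))
    rw [← a.naturality φ ψ, NatTrans.naturality_apply h ψ x]⟩
  map_one' := rfl
  map_mul' _ _ := rfl

end CharacterAt

/-- The dual monoid `𝔾^∨ = ℍom_mon(𝔾, 𝓡)`. -/
def dualMonoid (G : CommMonFunctor R) : CommMonFunctor R where
  obj S := CommMonCat.of (CharacterAt G S)
  map f := CommMonCat.ofHom (CharacterAt.restrict f)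
  map_id S := by
    refine CommMonCat.hom_ext (MonoidHom.ext fun (a : CharacterAt G S) => ?_)
    refine CharacterAt.ext_app fun φ => ?_
    change a.app (𝟙 S ≫ φ) = a.app φ
    rw [Category.id_comp]
  map_comp {S T U} f g := by
    refine CommMonCat.hom_ext (MonoidHom.ext fun (a : CharacterAt G S) => ?_)
    refine CharacterAt.ext_app fun φ => ?_
    change a.app ((f ≫ g) ≫ φ) = a.app (f ≫ g ≫ φ)
    rw [Category.assoc]

/-- The contravariant functor `𝔾 ↦ 𝔾^∨` on functors of abelian monoids. -/
def dualMonoidFunctor (R : Type u) [CommRing R] :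
    (CommMonFunctor R)ᵒᵖ ⥤ CommMonFunctor R where
  obj G := dualMonoid G.unop
  map h :=
    { app := fun S => CommMonCat.ofHom (CharacterAt.pullback h.unop S)
      naturality := fun _ _ _ => rfl }
  map_id _ := rfl
  map_comp _ _ := rfl

/-! ### Affine monoid schemes and formal monoids -/

/-- The functor of points `S ↦ Hom_{R-alg}(A, S)` of the affine `R`-scheme `Spec A`. -/
def affinePoints (A : CommAlgCat.{u} R) : CommAlgCat.{u} R ⥤ Type (u + 1) :=
  coyoneda.obj (op A) ⋙ uliftFunctor.{u + 1}

/-- The abelian affine `R`-monoid schemes `Spec A` with `A` a free `R`-module. -/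
def IsAffineMonoidScheme (R : Type u) [CommRing R] : ObjectProperty (CommMonFunctor R) :=
  fun G => ∃ A : CommAlgCat.{u} R, Module.Free R A ∧ Nonempty (G.toSet ≅ affinePoints A)

/-- The abelian formal monoids `Spec 𝓒^*`, where `C` is a free `R`-module and `𝓒^*` is a functor
of commutative algebras. -/
def IsFormalMonoid (R : Type u) [CommRing R] : ObjectProperty (CommMonFunctor R) :=
  fun G => ∃ (C : ModuleCat.{u} R) (A : AlgebraStructure (quasiCoherent R C).dual),
    Module.Free R C ∧ A.IsComm ∧ Nonempty (G.toSet ≅ A.spec)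

/-- The structure of functor of algebras on `𝔸_𝔾^*` makes the natural morphism `𝔾 → 𝔸_𝔾^*` a
morphism of functors of monoids. -/
def ExtendsMonoid (G : CommMonFunctor R) (A : AlgebraStructure (functions G.toSet).dual) : Prop :=
  ∀ S : CommAlgCat.{u} R, evalMap G.toSet S (1 : G.obj S) = A.one S ∧
    ∀ x y : G.obj S, evalMap G.toSet S (x * y : G.obj S) =
      A.mul S (evalMap G.toSet S x) (evalMap G.toSet S y)

end CartierDuality

end

open CartierDuality

universe w'

noncomputable section

namespace CartierDuality

variable {R : Type u} [CommRing R]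

/-! The theorem rests on two properties of the modules `𝓒` and `𝓒^*` with `C` free, bundled in
`ModuleFunctor.IsFunctional`: reflexivity, and the fact that for every commutative algebra structure
the functions on the spectrum are the elements of the functor itself. Hence if `𝔾` is affine or
formal, `𝔸_𝔾` is `𝓒` or `𝓒^*`, and is reflexive.

Reflexivity of `𝓒` comes from a universal element of `𝓒^*`, whose coordinates are the variables of a
polynomial ring: a linear function on `𝓒^*` takes a polynomial as its value there, so it involves
only finitely many coordinates (`exists_finite_support`). For functions on spectra, `Spec 𝓒` over
`S` is represented by the ring `𝓒(S)`, and Yoneda applies. `Spec 𝓒^*` is a union of representable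
pieces indexed by finite sets of coordinates, and the elements that represent a function on the
pieces glue coordinate by coordinate (`formal_bijective_toFunction`).

If `𝔸_𝔾` is reflexive, a linear function on `𝔸_𝔾^*` is a function on `𝔾`, so it is determined by its
values at points; the same holds for bilinear functions (`bilinear_ext`). This forces any product on
`𝔸_𝔾^*` extending that of `𝔾` to be convolution, and makes it commutative. The multiplicative linear
functions are exactly the characters, so `Spec 𝔸_𝔾^* = 𝔾^∨`. Since `𝔸_𝔾^*` is `𝓒^*` or `𝓒^{**} = 𝓒`,
duality interchanges the two classes.

For the bidual, the second property applied to `𝔸_𝔾^*` identifies it with the functions on `𝔾^∨`. A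
character of `𝔾^∨` is therefore a linear function on `𝔸_𝔾` that is multiplicative on characters.
Elements of `𝔸_𝔾^*` are determined by their values on characters, so it is multiplicative
everywhere, that is, a point of `𝔾` (`SpecPresentation.bijective_evalCharacter`). The
anti-equivalences follow formally. -/

lemma ModuleFunctor.dual_map_app (M : ModuleFunctor.{w} R) {S T U : CommAlgCat.{u} R}
    (f : S ⟶ T) (a : DualAt M S) (φ : T ⟶ U) :
    DualAt.app (M.dual.map f a) φ = a.app (f ≫ φ) := rfl

lemma DualAt.app_eq_id {M : ModuleFunctor.{w} R} {S T : CommAlgCat.{u} R} (a : DualAt M S)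
    (φ : S ⟶ T) : a.app φ = DualAt.app (M.dual.map φ a) (𝟙 T) := by
  rw [ModuleFunctor.dual_map_app, Category.comp_id]

lemma DualAt.app_map {M : ModuleFunctor.{w} R} {S T : CommAlgCat.{u} R} (a : DualAt M S)
    (φ : S ⟶ T) (x : M.obj S) : a.app φ (M.map φ x) = φ (a.app (𝟙 S) x) := by
  rw [← a.naturality, Category.id_comp]

lemma ModuleFunctor.toBidual_app (M : ModuleFunctor.{w} R) {S T : CommAlgCat.{u} R}
    (m : M.obj S) (φ : S ⟶ T) (a : DualAt M T) :
    DualAt.app (M.toBidual S m) φ a = a.app (𝟙 T) (M.map φ m) := rfl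

/-! ### Isomorphisms of functors of modules -/

/-- An isomorphism of functors of modules, possibly with values in different universes. -/
structure ModuleFunctor.Iso (M : ModuleFunctor.{w} R) (N : ModuleFunctor.{w'} R) where
  equiv : ∀ S : CommAlgCat.{u} R, M.obj S ≃ₗ[S] N.obj S
  naturality : ∀ {S T : CommAlgCat.{u} R} (f : S ⟶ T) (x : M.obj S),
    equiv T (M.map f x) = N.map f (equiv S x)

namespace ModuleFunctor.Iso

variable {M : ModuleFunctor.{w} R} {N : ModuleFunctor.{w'} R}

lemma symm_naturality (e : Iso M N) {S T : CommAlgCat.{u} R} (f : S ⟶ T) (y : N.obj S) :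
    (e.equiv T).symm (N.map f y) = M.map f ((e.equiv S).symm y) := by
  rw [LinearEquiv.symm_apply_eq, e.naturality, LinearEquiv.apply_symm_apply]

/-- The inverse isomorphism. -/
def symm (e : Iso M N) : Iso N M where
  equiv S := (e.equiv S).symm
  naturality := e.symm_naturality

/-- Transport of linear functions along an isomorphism. -/
def dualMap (e : Iso M N) (S : CommAlgCat.{u} R) (a : DualAt M S) : DualAt N S where
  app {T} φ := a.app φ ∘ₗ (e.equiv T).symm.toLinearMap
  naturality φ ψ x := by
    simp only [LinearMap.comp_apply, LinearEquiv.coe_coe, e.symm_naturality, a.naturality]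

lemma dualMap_app (e : Iso M N) {S T : CommAlgCat.{u} R} (a : DualAt M S) (φ : S ⟶ T)
    (x : N.obj T) : (e.dualMap S a).app φ x = a.app φ ((e.equiv T).symm x) := rfl

/-- The isomorphism of dual functors. -/
def dual (e : Iso M N) : Iso M.dual N.dual where
  equiv S :=
    { toFun := fun a => e.dualMap S a
      invFun := fun b => e.symm.dualMap S b
      map_add' := fun _ _ => rfl
      map_smul' := fun _ _ => rfl
      left_inv := fun a => DualAt.ext_app fun {T} φ => LinearMap.ext fun x => by
        rw [dualMap_app, dualMap_app]
        exact congrArg _ ((e.equiv T).symm_apply_apply x)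
      right_inv := fun a => DualAt.ext_app fun {T} φ => LinearMap.ext fun x => by
        rw [dualMap_app, dualMap_app]
        exact congrArg _ ((e.equiv T).apply_symm_apply x) }
  naturality _ _ := rfl

lemma dual_equiv_app (e : Iso M N) {S T : CommAlgCat.{u} R} (a : DualAt M S) (φ : S ⟶ T)
    (x : N.obj T) : DualAt.app (e.dual.equiv S a) φ x = a.app φ ((e.equiv T).symm x) := rfl

lemma dual_equiv_symm_app (e : Iso M N) {S T : CommAlgCat.{u} R} (a : DualAt N S) (φ : S ⟶ T)
    (x : M.obj T) : DualAt.app ((e.dual.equiv S).symm a) φ x = a.app φ (e.equiv T x) := rfl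

lemma isReflexive (e : Iso M N) (h : M.IsReflexive) : N.IsReflexive := by
  intro S
  have key : N.toBidual S = e.dual.dual.equiv S ∘ M.toBidual S ∘ (e.equiv S).symm := by
    funext y
    refine DualAt.ext_app fun {T} φ => LinearMap.ext fun (a : DualAt N T) => ?_
    change a.app (𝟙 T) (N.map φ y) =
      a.app (𝟙 T) (e.equiv T (M.map φ ((e.equiv S).symm y)))
    rw [e.naturality, LinearEquiv.apply_symm_apply]
  rw [key]
  exact (e.dual.dual.equiv S).bijective.comp ((h S).comp (e.equiv S).symm.bijective)

end ModuleFunctor.Iso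

/-- The natural morphism to the bidual, as linear maps. -/
def ModuleFunctor.toBidualLinear (M : ModuleFunctor.{w} R) (S : CommAlgCat.{u} R) :
    M.obj S →ₗ[S] M.dual.dual.obj S where
  toFun := M.toBidual S
  map_add' x y := DualAt.ext_app fun {T} φ => LinearMap.ext fun (a : DualAt M T) => by
    change a.app (𝟙 T) (M.map φ (x + y)) =
      a.app (𝟙 T) (M.map φ x) + a.app (𝟙 T) (M.map φ y)
    rw [map_add, map_add]
  map_smul' s x := DualAt.ext_app fun {T} φ => LinearMap.ext fun (a : DualAt M T) => by
    change a.app (𝟙 T) (M.map φ (s • x)) = φ s • a.app (𝟙 T) (M.map φ x)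
    rw [M.map_smul]
    exact _root_.map_smul (a.app (𝟙 T)) _ _

/-- A reflexive functor of modules is isomorphic to its bidual. -/
def ModuleFunctor.IsReflexive.iso {M : ModuleFunctor.{w} R} (h : M.IsReflexive) :
    M.Iso M.dual.dual where
  equiv S := LinearEquiv.ofBijective (M.toBidualLinear S) (h S)
  naturality {S T} f x := DualAt.ext_app fun {U} φ => LinearMap.ext fun (a : DualAt M U) => by
    change a.app (𝟙 U) (M.map φ (M.map f x)) = a.app (𝟙 U) (M.map (f ≫ φ) x)
    rw [M.map_comp]

/-- By the triangle identity, restricting along `𝕄 → 𝕄^{**}` is a left inverse of the evaluation map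
of `𝕄^*`. For `𝕄` reflexive this restriction is an isomorphism, so the evaluation map is its
inverse. -/
lemma ModuleFunctor.IsReflexive.dual {M : ModuleFunctor.{w} R} (h : M.IsReflexive) :
    M.dual.IsReflexive := by
  intro S
  have key : M.dual.toBidual S = h.iso.dual.equiv S := by
    funext a
    rw [← LinearEquiv.symm_apply_eq]
    refine DualAt.ext_app fun {T} φ => LinearMap.ext fun x => ?_
    change DualAt.app (M.dual.map φ a) (𝟙 T) (M.map (𝟙 T) x) = a.app φ x
    rw [M.map_id, ← DualAt.app_eq_id]
  rw [key]
  exact (h.iso.dual.equiv S).bijective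

/-! ### Transport of algebra structures, presentations as spectra -/

/-- Transport of an algebra structure along an isomorphism of functors of modules. -/
def AlgebraStructure.transport {M : ModuleFunctor.{w} R} {N : ModuleFunctor.{w'} R}
    (A : AlgebraStructure M) (e : M.Iso N) : AlgebraStructure N where
  mul S := LinearMap.mk₂ S
    (fun x y => e.equiv S (A.mul S ((e.equiv S).symm x) ((e.equiv S).symm y)))
    (by simp) (by simp) (by simp) (by simp)
  one S := e.equiv S (A.one S)
  mul_assoc S x y z := by simp [A.mul_assoc]
  one_mul S x := by simp [A.one_mul]
  mul_one S x := by simp [A.mul_one]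
  map_mul f x y := by
    simp only [LinearMap.mk₂_apply, e.symm_naturality, ← e.naturality, A.map_mul]
  map_one f := by rw [← e.naturality, A.map_one]

lemma AlgebraStructure.transport_mul {M : ModuleFunctor.{w} R} {N : ModuleFunctor.{w'} R}
    (A : AlgebraStructure M) (e : M.Iso N) (S : CommAlgCat.{u} R) (x y : N.obj S) :
    (A.transport e).mul S x y =
      e.equiv S (A.mul S ((e.equiv S).symm x) ((e.equiv S).symm y)) := rfl

lemma AlgebraStructure.IsComm.transport {M : ModuleFunctor.{w} R} {N : ModuleFunctor.{w'} R}
    {A : AlgebraStructure M} (h : A.IsComm) (e : M.Iso N) : (A.transport e).IsComm :=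
  fun S x y => by rw [A.transport_mul, A.transport_mul, h]

/-- An identification of a functor of sets with the spectrum of a functor of algebras. -/
structure SpecPresentation {M : ModuleFunctor.{w} R} (X : CommAlgCat.{u} R ⥤ Type w')
    (A : AlgebraStructure M) where
  equiv : ∀ S : CommAlgCat.{u} R, X.obj S ≃ A.SpecAt S
  naturality : ∀ {S T : CommAlgCat.{u} R} (f : S ⟶ T) (x : X.obj S),
    (equiv T (X.map f x)).toDual = M.dual.map f (equiv S x).toDual

/-- Points of the spectrum are transported along isomorphisms. -/
def AlgebraStructure.specEquiv {M : ModuleFunctor.{w} R} {N : ModuleFunctor.{w'} R}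
    (A : AlgebraStructure M) (e : M.Iso N) (S : CommAlgCat.{u} R) :
    A.SpecAt S ≃ (A.transport e).SpecAt S where
  toFun p := ⟨e.dual.equiv S p.toDual,
    fun {T} φ x y => by
      rw [e.dual_equiv_app, e.dual_equiv_app, e.dual_equiv_app, ← p.map_mul, A.transport_mul,
        LinearEquiv.symm_apply_apply],
    fun {T} φ => by
      rw [e.dual_equiv_app, ← p.map_one φ]
      exact congrArg _ ((e.equiv T).symm_apply_apply _)⟩
  invFun q := ⟨(e.dual.equiv S).symm q.toDual,
    fun {T} φ x y => by
      rw [e.dual_equiv_symm_app, e.dual_equiv_symm_app, e.dual_equiv_symm_app, ← q.map_mul,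
        A.transport_mul, LinearEquiv.symm_apply_apply, LinearEquiv.symm_apply_apply],
    fun {T} φ => by
      rw [e.dual_equiv_symm_app]
      exact q.map_one φ⟩
  left_inv p := AlgebraStructure.SpecAt.ext ((e.dual.equiv S).symm_apply_apply _)
  right_inv q := AlgebraStructure.SpecAt.ext ((e.dual.equiv S).apply_symm_apply _)

/-- Change of the functor of algebras in a presentation. -/
def SpecPresentation.transport {M : ModuleFunctor.{w} R} {N : ModuleFunctor.{w'} R}
    {X : CommAlgCat.{u} R ⥤ Type (u + 1)} {A : AlgebraStructure M} (P : SpecPresentation X A)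
    (e : M.Iso N) : SpecPresentation X (A.transport e) where
  equiv S := (P.equiv S).trans (A.specEquiv e S)
  naturality {S T} f x := by
    change e.dual.equiv T (P.equiv T (X.map f x)).toDual = _
    rw [P.naturality, e.dual.naturality]
    rfl

/-- The function on the spectrum defined by an element of the functor of algebras. -/
def AlgebraStructure.toFunction {M : ModuleFunctor.{w} R} (A : AlgebraStructure M)
    (S : CommAlgCat.{u} R) (m : M.obj S) : FunctionAt A.spec S where
  app {T} φ (p : A.SpecAt T) := p.toDual.app (𝟙 T) (M.map φ m)
  naturality {T T'} φ ψ (p : A.SpecAt T) := by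
    change p.toDual.app (ψ ≫ 𝟙 T') (M.map (φ ≫ ψ) m) = ψ (p.toDual.app (𝟙 T) (M.map φ m))
    rw [← p.toDual.naturality (𝟙 T) ψ, Category.comp_id, Category.id_comp, M.map_comp]

lemma AlgebraStructure.toFunction_app {M : ModuleFunctor.{w} R} (A : AlgebraStructure M)
    {S T : CommAlgCat.{u} R} (m : M.obj S) (φ : S ⟶ T) (p : A.SpecAt T) :
    (A.toFunction S m).app φ p = p.toDual.app (𝟙 T) (M.map φ m) := rfl

/-- A reflexive functor of modules such that, for every structure of functor of commutative
algebras on it, it is the functor of functions on its spectrum. -/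
def ModuleFunctor.IsFunctional (M : ModuleFunctor.{w} R) : Prop :=
  M.IsReflexive ∧ ∀ A : AlgebraStructure M, A.IsComm → ∀ S, Function.Bijective (A.toFunction S)

/-- Functions on a functor presented as a spectrum. -/
def SpecPresentation.functionsIso {M : ModuleFunctor.{w} R} {X : CommAlgCat.{u} R ⥤ Type w'}
    {A : AlgebraStructure M} (P : SpecPresentation X A)
    (h : ∀ S, Function.Bijective (A.toFunction S)) : M.Iso (functions X) where
  equiv S := LinearEquiv.ofBijective
    { toFun := fun m => (⟨fun {T} φ x => (P.equiv T x).toDual.app (𝟙 T) (M.map φ m),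
        fun {T T'} φ ψ x => by
          rw [P.naturality]
          exact (A.toFunction S m).naturality φ ψ (P.equiv T x)⟩ : FunctionAt X S)
      map_add' := fun a b => FunctionAt.ext_app fun φ x => by
        simp only [FunctionAt.add_app, map_add]
      map_smul' := fun s a => FunctionAt.ext_app fun φ x => by
        simp only [FunctionAt.smul_app, RingHom.id_apply, M.map_smul, map_smul, smul_eq_mul] }
    ⟨fun m m' hm => (h S).1 <| FunctionAt.ext_app fun {T} φ (p : A.SpecAt T) => by
        have := congrArg (fun f : FunctionAt X S => f.app φ ((P.equiv T).symm p)) hm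
        change (P.equiv T ((P.equiv T).symm p)).toDual.app (𝟙 T) (M.map φ m) =
          (P.equiv T ((P.equiv T).symm p)).toDual.app (𝟙 T) (M.map φ m') at this
        rwa [Equiv.apply_symm_apply] at this,
      fun f => by
        obtain ⟨m, hm⟩ := (h S).2 ⟨fun {T} φ (p : A.SpecAt T) => f.app φ ((P.equiv T).symm p),
          fun {T T'} φ ψ (p : A.SpecAt T) => by
            rw [← f.naturality]
            refine congrArg _ ?_
            refine (Equiv.symm_apply_eq _).2 (AlgebraStructure.SpecAt.ext ?_)
            rw [P.naturality, Equiv.apply_symm_apply]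
            rfl⟩
        refine ⟨m, FunctionAt.ext_app fun {T} φ x => ?_⟩
        refine (congrArg (fun f : FunctionAt A.spec S => f.app φ (P.equiv T x)) hm).trans ?_
        change f.app φ ((P.equiv T).symm (P.equiv T x)) = _
        rw [Equiv.symm_apply_apply]⟩
  naturality {S T} f m := FunctionAt.ext_app fun {U} φ x => by
    change (P.equiv U x).toDual.app (𝟙 U) (M.map φ (M.map f m)) =
      (P.equiv U x).toDual.app (𝟙 U) (M.map (f ≫ φ) m)
    rw [M.map_comp]

lemma SpecPresentation.functionsIso_app {M : ModuleFunctor.{w} R}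
    {X : CommAlgCat.{u} R ⥤ Type w'} {A : AlgebraStructure M} (P : SpecPresentation X A)
    (h : ∀ S, Function.Bijective (A.toFunction S)) {S T : CommAlgCat.{u} R} (m : M.obj S)
    (φ : S ⟶ T) (x : X.obj T) :
    FunctionAt.app ((P.functionsIso h).equiv S m) φ x =
      (P.equiv T x).toDual.app (𝟙 T) (M.map φ m) := rfl

/-! ### Functions and their duals -/

lemma functions_map_app {X : CommAlgCat.{u} R ⥤ Type w} {S T U : CommAlgCat.{u} R} (f : S ⟶ T)
    (a : FunctionAt X S) (φ : T ⟶ U) (x : X.obj U) :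
    FunctionAt.app ((functions X).map f a) φ x = a.app (f ≫ φ) x := rfl

lemma evalMap_app {X : CommAlgCat.{u} R ⥤ Type w} {S T : CommAlgCat.{u} R} (x : X.obj S)
    (φ : S ⟶ T) (f : FunctionAt X T) :
    DualAt.app (evalMap X S x) φ f = f.app (𝟙 T) (X.map φ x) := rfl

lemma evalMap_map {X : CommAlgCat.{u} R ⥤ Type w} {S T : CommAlgCat.{u} R} (x : X.obj S)
    (φ : S ⟶ T) : evalMap X T (X.map φ x) = (functions X).dual.map φ (evalMap X S x) := by
  refine DualAt.ext_app fun {U} ψ => LinearMap.ext fun (f : FunctionAt X U) => ?_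
  change f.app (𝟙 U) (X.map ψ (X.map φ x)) = f.app (𝟙 U) (X.map (φ ≫ ψ) x)
  rw [Functor.map_comp]
  rfl

/-- A linear function on the dual of a reflexive functor of functions is determined by its values
at the points. -/
lemma bidual_ext {X : CommAlgCat.{u} R ⥤ Type w} (h : (functions X).IsReflexive)
    {S : CommAlgCat.{u} R} {F F' : DualAt (functions X).dual S}
    (hF : ∀ {T : CommAlgCat.{u} R} (φ : S ⟶ T) (x : X.obj T),
      F.app φ (evalMap X T x) = F'.app φ (evalMap X T x)) : F = F' := by
  -- Reflexivity turns `F` and `F'` into functions on `𝕏`, whose values at `x` are those of `F` and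
  -- `F'` at the evaluation at `x`.
  obtain ⟨f, rfl⟩ := (h S).2 F
  obtain ⟨f', rfl⟩ := (h S).2 F'
  refine congrArg _ (FunctionAt.ext_app fun {T} φ x => ?_)
  have := hF φ x
  change FunctionAt.app ((functions X).map φ f) (𝟙 T) (X.map (𝟙 T) x) =
    FunctionAt.app ((functions X).map φ f') (𝟙 T) (X.map (𝟙 T) x) at this
  rw [functions_map_app, functions_map_app, CategoryTheory.Functor.map_id, Category.comp_id] at this
  exact this

/-- Bilinear functions on `𝔸_𝕏^*` that agree at pairs of points are equal. -/
lemma bilinear_ext {X : CommAlgCat.{u} R ⥤ Type w} (h : (functions X).IsReflexive)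
    {S : CommAlgCat.{u} R}
    (β β' : ∀ {T : CommAlgCat.{u} R}, (S ⟶ T) →
      (DualAt (functions X) T →ₗ[T] DualAt (functions X) T →ₗ[T] T))
    (hβ : ∀ {T T' : CommAlgCat.{u} R} (φ : S ⟶ T) (ψ : T ⟶ T') (a b : DualAt (functions X) T),
      β (φ ≫ ψ) ((functions X).dual.map ψ a) ((functions X).dual.map ψ b) = ψ (β φ a b))
    (hβ' : ∀ {T T' : CommAlgCat.{u} R} (φ : S ⟶ T) (ψ : T ⟶ T') (a b : DualAt (functions X) T),
      β' (φ ≫ ψ) ((functions X).dual.map ψ a) ((functions X).dual.map ψ b) = ψ (β' φ a b))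
    (hp : ∀ {T : CommAlgCat.{u} R} (φ : S ⟶ T) (x y : X.obj T),
      β φ (evalMap X T x) (evalMap X T y) = β' φ (evalMap X T x) (evalMap X T y))
    {T : CommAlgCat.{u} R} (φ : S ⟶ T) (a b : DualAt (functions X) T) :
    β φ a b = β' φ a b := by
  -- With the first argument frozen at a point, both forms become elements of the bidual that agree
  -- at points.
  have aux : ∀ {T : CommAlgCat.{u} R} (φ : S ⟶ T) (x : X.obj T) (b : DualAt (functions X) T),
      β φ (evalMap X T x) b = β' φ (evalMap X T x) b := by
    intro T φ x b
    let F (γ : ∀ {T : CommAlgCat.{u} R}, (S ⟶ T) →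
        (DualAt (functions X) T →ₗ[T] DualAt (functions X) T →ₗ[T] T))
        (hγ : ∀ {T T' : CommAlgCat.{u} R} (φ : S ⟶ T) (ψ : T ⟶ T')
          (a b : DualAt (functions X) T), γ (φ ≫ ψ) ((functions X).dual.map ψ a)
            ((functions X).dual.map ψ b) = ψ (γ φ a b)) : DualAt (functions X).dual T :=
      ⟨fun {T'} ψ => γ (φ ≫ ψ) (evalMap X T' (X.map ψ x)), fun {T' T''} ψ χ b => by
        rw [← hγ, Functor.map_comp, Category.assoc, ← evalMap_map]
        rfl⟩
    have hF : F β hβ = F β' hβ' := bidual_ext h fun {T'} ψ y => hp (φ ≫ ψ) _ _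
    have := congrArg (fun G : DualAt (functions X).dual T => G.app (𝟙 T) b) hF
    change β (φ ≫ 𝟙 T) (evalMap X T (X.map (𝟙 T) x)) b =
      β' (φ ≫ 𝟙 T) (evalMap X T (X.map (𝟙 T) x)) b at this
    rw [Category.comp_id, CategoryTheory.Functor.map_id] at this
    exact this
  -- The second argument is now arbitrary and frozen; by `aux` the two linear functions of the first
  -- argument agree at points.
  let F (γ : ∀ {T : CommAlgCat.{u} R}, (S ⟶ T) →
      (DualAt (functions X) T →ₗ[T] DualAt (functions X) T →ₗ[T] T))
      (hγ : ∀ {T T' : CommAlgCat.{u} R} (φ : S ⟶ T) (ψ : T ⟶ T')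
        (a b : DualAt (functions X) T), γ (φ ≫ ψ) ((functions X).dual.map ψ a)
          ((functions X).dual.map ψ b) = ψ (γ φ a b)) : DualAt (functions X).dual T :=
    ⟨fun {T'} ψ => (γ (φ ≫ ψ)).flip ((functions X).dual.map ψ b), fun {T' T''} ψ χ a => by
      rw [LinearMap.flip_apply, LinearMap.flip_apply, ← hγ, Category.assoc,
        ← (functions X).dual.map_comp]⟩
  have hF : F β hβ = F β' hβ' := bidual_ext h fun {T'} ψ y => aux (φ ≫ ψ) _ _
  have := congrArg (fun G : DualAt (functions X).dual T => G.app (𝟙 T) a) hF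
  change β (φ ≫ 𝟙 T) a ((functions X).dual.map (𝟙 T) b) =
    β' (φ ≫ 𝟙 T) a ((functions X).dual.map (𝟙 T) b) at this
  rwa [Category.comp_id, (functions X).dual.map_id] at this

/-! ### The convolution product -/

section Convolution

variable {G : CommMonFunctor R}

lemma CommMonFunctor.map_mul_apply {S T : CommAlgCat.{u} R} (φ : S ⟶ T) (x y : G.obj S) :
    G.map φ (x * y) = G.map φ x * G.map φ y := map_mul (G.map φ).hom x y

lemma CommMonFunctor.map_one_apply {S T : CommAlgCat.{u} R} (φ : S ⟶ T) :
    G.map φ (1 : G.obj S) = 1 := map_one (G.map φ).hom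

lemma CommMonFunctor.map_comp_apply {S T U : CommAlgCat.{u} R} (φ : S ⟶ T) (ψ : T ⟶ U)
    (x : G.obj S) : G.map (φ ≫ ψ) x = G.map ψ (G.map φ x) := by
  rw [Functor.map_comp]; rfl

lemma CommMonFunctor.map_id_apply {S : CommAlgCat.{u} R} (x : G.obj S) :
    G.map (𝟙 S) x = x := by
  rw [CategoryTheory.Functor.map_id]; rfl

/-- The translate `y ↦ f(xy)` of a function. -/
def translate {T : CommAlgCat.{u} R} (x : G.obj T) :
    FunctionAt G.toSet T →ₗ[T] FunctionAt G.toSet T where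
  toFun f := ⟨fun {T'} φ (y : G.obj T') => f.app φ (G.map φ x * y : G.obj T'),
    fun {T' T''} φ ψ (y : G.obj T') => by
      rw [← f.naturality]
      change f.app (φ ≫ ψ) (G.map (φ ≫ ψ) x * G.map ψ y : G.obj T'') =
        f.app (φ ≫ ψ) (G.map ψ (G.map φ x * y))
      rw [CommMonFunctor.map_mul_apply, CommMonFunctor.map_comp_apply]⟩
  map_add' _ _ := rfl
  map_smul' _ _ := rfl

lemma translate_app {T T' : CommAlgCat.{u} R} (x : G.obj T) (f : FunctionAt G.toSet T)
    (φ : T ⟶ T') (y : G.obj T') :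
    (translate x f).app φ y = f.app φ (G.map φ x * y : G.obj T') := rfl

lemma translate_map {T T' : CommAlgCat.{u} R} (x : G.obj T) (f : FunctionAt G.toSet T)
    (φ : T ⟶ T') : (functions G.toSet).map φ (translate x f) =
      translate (G.map φ x) ((functions G.toSet).map φ f) := by
  refine FunctionAt.ext_app fun {T''} ψ (y : G.obj T'') => ?_
  rw [functions_map_app, translate_app, translate_app, functions_map_app,
    CommMonFunctor.map_comp_apply]

lemma translate_mul {T : CommAlgCat.{u} R} (x y : G.obj T) (f : FunctionAt G.toSet T) :
    translate (x * y) f = translate y (translate x f) := by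
  refine FunctionAt.ext_app fun {T'} φ (z : G.obj T') => ?_
  rw [translate_app, translate_app, translate_app, CommMonFunctor.map_mul_apply, mul_assoc]

/-- The function `x ↦ b(y ↦ f(xy))`. -/
def integrate {T : CommAlgCat.{u} R} (b : DualAt (functions G.toSet) T) :
    FunctionAt G.toSet T →ₗ[T] FunctionAt G.toSet T where
  toFun f := ⟨fun {T'} φ (x : G.obj T') =>
      b.app φ (translate x ((functions G.toSet).map φ f)),
    fun {T' T''} φ ψ (x : G.obj T') => by
      rw [← b.naturality, translate_map, (functions G.toSet).map_comp]
      rfl⟩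
  map_add' f g := FunctionAt.ext_app fun φ x => by
    simp only [map_add, FunctionAt.add_app]
  map_smul' t f := FunctionAt.ext_app fun φ x => by
    simp only [FunctionAt.smul_app, (functions G.toSet).map_smul, map_smul, RingHom.id_apply,
      smul_eq_mul]

lemma integrate_app {T T' : CommAlgCat.{u} R} (b : DualAt (functions G.toSet) T)
    (f : FunctionAt G.toSet T) (φ : T ⟶ T') (x : G.obj T') :
    (integrate b f).app φ x = b.app φ (translate x ((functions G.toSet).map φ f)) := rfl

lemma integrate_map {T T' : CommAlgCat.{u} R} (b : DualAt (functions G.toSet) T)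
    (f : FunctionAt G.toSet T) (φ : T ⟶ T') : (functions G.toSet).map φ (integrate b f) =
      integrate ((functions G.toSet).dual.map φ b) ((functions G.toSet).map φ f) := by
  refine FunctionAt.ext_app fun {T''} ψ (y : G.obj T'') => ?_
  rw [functions_map_app, integrate_app, integrate_app, ModuleFunctor.dual_map_app,
    (functions G.toSet).map_comp]

/-- The convolution product on `𝔸_𝔾^*`. -/
def convolve {S : CommAlgCat.{u} R} (a b : DualAt (functions G.toSet) S) :
    DualAt (functions G.toSet) S where
  app {T} φ := a.app φ ∘ₗ integrate ((functions G.toSet).dual.map φ b)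
  naturality {T T'} φ ψ (f : FunctionAt G.toSet T) := by
    rw [LinearMap.comp_apply, LinearMap.comp_apply, ← a.naturality, integrate_map,
      (functions G.toSet).dual.map_comp]

lemma convolve_app {S T : CommAlgCat.{u} R} (a b : DualAt (functions G.toSet) S) (φ : S ⟶ T)
    (f : FunctionAt G.toSet T) : (convolve a b).app φ f =
      a.app φ (integrate ((functions G.toSet).dual.map φ b) f) := rfl

lemma convolve_map {S T : CommAlgCat.{u} R} (φ : S ⟶ T) (a b : DualAt (functions G.toSet) S) :
    (functions G.toSet).dual.map φ (convolve a b) =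
      convolve ((functions G.toSet).dual.map φ a) ((functions G.toSet).dual.map φ b) := by
  refine DualAt.ext_app fun {T'} ψ => LinearMap.ext fun f => ?_
  rw [ModuleFunctor.dual_map_app, convolve_app, convolve_app, ModuleFunctor.dual_map_app,
    (functions G.toSet).dual.map_comp]

lemma integrate_add {S : CommAlgCat.{u} R} (a b : DualAt (functions G.toSet) S) :
    integrate (a + b) = integrate a + integrate b := rfl

lemma integrate_smul {S : CommAlgCat.{u} R} (s : S) (a : DualAt (functions G.toSet) S) :
    integrate (s • a) = s • integrate a := rfl

/-- Associativity of `𝔾` makes `b ↦ integrate b` multiplicative, so associativity of convolution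
reduces to that of composition of operators. -/
lemma integrate_convolve {S : CommAlgCat.{u} R} (a b : DualAt (functions G.toSet) S)
    (f : FunctionAt G.toSet S) : integrate (convolve a b) f = integrate a (integrate b f) := by
  refine FunctionAt.ext_app fun {T} φ (x : G.obj T) => ?_
  rw [integrate_app, integrate_app, convolve_app]
  refine congrArg _ (FunctionAt.ext_app fun {T'} ψ (y : G.obj T') => ?_)
  rw [integrate_app, translate_app, functions_map_app, integrate_app,
    ModuleFunctor.dual_map_app, translate_map, translate_mul, (functions G.toSet).map_comp]

lemma integrate_evalMap_one {S : CommAlgCat.{u} R} (f : FunctionAt G.toSet S) :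
    integrate (evalMap G.toSet S (1 : G.obj S)) f = f := by
  refine FunctionAt.ext_app fun {T} φ (x : G.obj T) => ?_
  rw [integrate_app, evalMap_app]
  change f.app (φ ≫ 𝟙 T) (G.map (𝟙 T) x * G.map φ 1 : G.obj T) = _
  rw [CommMonFunctor.map_one_apply, CommMonFunctor.map_id_apply, mul_one, Category.comp_id]

lemma evalMap_one_map {S T : CommAlgCat.{u} R} (φ : S ⟶ T) :
    (functions G.toSet).dual.map φ (evalMap G.toSet S (1 : G.obj S)) =
      evalMap G.toSet T (1 : G.obj T) := by
  rw [← evalMap_map]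
  exact congrArg (evalMap G.toSet T) (CommMonFunctor.map_one_apply φ)

/-- The structure of functor of algebras on `𝔸_𝔾^*` given by convolution. -/
def convolution (G : CommMonFunctor R) : AlgebraStructure (functions G.toSet).dual where
  mul S := LinearMap.mk₂ S convolve (fun _ _ _ => rfl) (fun _ _ _ => rfl)
    (fun a b c => DualAt.ext_app fun {T} φ => LinearMap.ext fun f => by
      rw [DualAt.add_app, LinearMap.add_apply, convolve_app, convolve_app, convolve_app,
        map_add, integrate_add, LinearMap.add_apply, map_add])
    (fun s a b => DualAt.ext_app fun {T} φ => LinearMap.ext fun f => by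
      rw [DualAt.smul_app, LinearMap.smul_apply, convolve_app, convolve_app,
        (functions G.toSet).dual.map_smul, integrate_smul, LinearMap.smul_apply, map_smul])
  one S := evalMap G.toSet S (1 : G.obj S)
  mul_assoc S a b c := DualAt.ext_app fun {T} φ => LinearMap.ext fun f => by
    change (convolve (convolve a b) c).app φ f = (convolve a (convolve b c)).app φ f
    rw [convolve_app, convolve_app, convolve_app, convolve_map, integrate_convolve]
  one_mul S a := DualAt.ext_app fun {T} φ => LinearMap.ext fun (f : FunctionAt G.toSet T) => by
    change (convolve (evalMap G.toSet S (1 : G.obj S)) a).app φ f = _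
    rw [convolve_app, evalMap_app, integrate_app]
    change DualAt.app ((functions G.toSet).dual.map φ a) (𝟙 T) (translate (G.map φ 1)
      ((functions G.toSet).map (𝟙 T) f)) = _
    rw [← DualAt.app_eq_id, (functions G.toSet).map_id, CommMonFunctor.map_one_apply]
    refine congrArg _ (FunctionAt.ext_app fun {T'} ψ (y : G.obj T') => ?_)
    rw [translate_app, CommMonFunctor.map_one_apply, one_mul]
  mul_one S a := DualAt.ext_app fun {T} φ => LinearMap.ext fun f => by
    change (convolve a (evalMap G.toSet S (1 : G.obj S))).app φ f = _
    rw [convolve_app, evalMap_one_map, integrate_evalMap_one]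
  map_mul φ a b := convolve_map φ a b
  map_one φ := evalMap_one_map φ

lemma convolution_mul {S : CommAlgCat.{u} R} (a b : DualAt (functions G.toSet) S) :
    (convolution G).mul S a b = convolve a b := rfl

lemma extendsMonoid_convolution (G : CommMonFunctor R) : ExtendsMonoid G (convolution G) := by
  refine fun S => ⟨rfl, fun x y => ?_⟩
  refine DualAt.ext_app fun {T} φ => LinearMap.ext fun (f : FunctionAt G.toSet T) => ?_
  change f.app (𝟙 T) (G.map φ (x * y)) =
    f.app (𝟙 T ≫ 𝟙 T) (G.map (𝟙 T) (G.map φ x) * G.map (φ ≫ 𝟙 T) y : G.obj T)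
  rw [CommMonFunctor.map_mul_apply, CommMonFunctor.map_id_apply, Category.comp_id,
    Category.comp_id]

/-- Two algebra structures on `𝔸_𝔾^*` that extend the product of `𝔾` are opposite to each other. -/
lemma ExtendsMonoid.mul_eq (h : (functions G.toSet).IsReflexive)
    {A A' : AlgebraStructure (functions G.toSet).dual} (hA : ExtendsMonoid G A)
    (hA' : ExtendsMonoid G A') {S : CommAlgCat.{u} R} (a b : DualAt (functions G.toSet) S) :
    A.mul S a b = A'.mul S b a := by
  refine DualAt.ext_app fun {T} φ => LinearMap.ext fun (f : FunctionAt G.toSet T) => ?_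
  -- Evaluation at the fixed `f` turns the two products into scalar bilinear forms, to which
  -- `bilinear_ext` applies.
  let ev {U : CommAlgCat.{u} R} (ψ : T ⟶ U) : DualAt (functions G.toSet) U →ₗ[U] U :=
    DualAt.app ((functions G.toSet).toBidual T f) ψ
  have hev : ∀ {U V : CommAlgCat.{u} R} (ψ : T ⟶ U) (χ : U ⟶ V)
      (a : DualAt (functions G.toSet) U), ev (ψ ≫ χ) ((functions G.toSet).dual.map χ a) =
        χ (ev ψ a) :=
    fun ψ χ a => DualAt.naturality ((functions G.toSet).toBidual T f) ψ χ a
  have key := bilinear_ext h (S := T) (fun {U} ψ => (A.mul U).compr₂ (ev ψ))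
    (fun {U} ψ => (A'.mul U).flip.compr₂ (ev ψ))
    (fun ψ χ a b => by
      simp only [LinearMap.compr₂_apply]
      rw [← A.map_mul, hev])
    (fun ψ χ a b => by
      simp only [LinearMap.compr₂_apply, LinearMap.flip_apply]
      rw [← A'.map_mul, hev])
    (fun {U} ψ x y => by
      simp only [LinearMap.compr₂_apply, LinearMap.flip_apply]
      have h₁ := (hA U).2 x y
      have h₂ := (hA' U).2 y x
      -- Commutativity of `𝔾` enters here: both forms take the value `f(xy) = f(yx)` at a pair of
      -- points.
      rw [mul_comm, h₁] at h₂
      exact congrArg _ h₂)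
    (𝟙 T) ((functions G.toSet).dual.map φ a) ((functions G.toSet).dual.map φ b)
  simp only [LinearMap.compr₂_apply, LinearMap.flip_apply] at key
  rw [← A.map_mul, ← A'.map_mul] at key
  change DualAt.app ((functions G.toSet).dual.map φ (A.mul S a b)) (𝟙 T)
      ((functions G.toSet).map (𝟙 T) f) =
    DualAt.app ((functions G.toSet).dual.map φ (A'.mul S b a)) (𝟙 T)
      ((functions G.toSet).map (𝟙 T) f) at key
  rwa [← DualAt.app_eq_id, ← DualAt.app_eq_id, (functions G.toSet).map_id] at key

/-- Two structures extending the product of `𝔾` are opposite to each other; comparing convolution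
with itself gives commutativity. -/
lemma convolution_isComm (h : (functions G.toSet).IsReflexive) : (convolution G).IsComm :=
  fun _ _ _ => (extendsMonoid_convolution G).mul_eq h (extendsMonoid_convolution G) _ _

lemma ExtendsMonoid.eq_convolution (h : (functions G.toSet).IsReflexive)
    {A : AlgebraStructure (functions G.toSet).dual} (hA : ExtendsMonoid G A) :
    A = convolution G := by
  refine AlgebraStructure.ext ?_ (funext fun S => ((hA S).1).symm)
  funext S
  refine LinearMap.ext₂ fun a b => ?_
  rw [convolution_isComm h]
  exact hA.mul_eq h (extendsMonoid_convolution G) a b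

/-- A character, as a function. -/
def CharacterAt.toFunction {S : CommAlgCat.{u} R} (χ : CharacterAt G S) :
    FunctionAt G.toSet S where
  app {T} φ (x : G.obj T) := χ.app φ x
  naturality φ ψ x := χ.naturality φ ψ x

lemma CharacterAt.toFunction_app {S T : CommAlgCat.{u} R} (χ : CharacterAt G S) (φ : S ⟶ T)
    (x : G.obj T) : χ.toFunction.app φ x = χ.app φ x := rfl

lemma CharacterAt.toFunction_restrict {S T : CommAlgCat.{u} R} (χ : CharacterAt G S)
    (f : S ⟶ T) : (CharacterAt.restrict f χ).toFunction =
      (functions G.toSet).map f χ.toFunction := rfl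

/-- The translate of `χ` by `x` is `χ(x)χ`, so a character is an eigenvector of every convolution
operator. This is why evaluation at `χ` is multiplicative on `𝔸_𝔾^*`. -/
lemma integrate_character {S : CommAlgCat.{u} R} (χ : CharacterAt G S)
    (b : DualAt (functions G.toSet) S) :
    integrate b χ.toFunction = b.app (𝟙 S) χ.toFunction • χ.toFunction := by
  refine FunctionAt.ext_app fun {T} φ (x : G.obj T) => ?_
  rw [integrate_app, FunctionAt.smul_app, CharacterAt.toFunction_app, ← DualAt.app_map, mul_comm,
    ← smul_eq_mul, ← map_smul]
  refine congrArg _ (FunctionAt.ext_app fun {U} ψ (y : G.obj U) => ?_)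
  rw [translate_app, functions_map_app, CharacterAt.toFunction_app, FunctionAt.smul_app,
    functions_map_app, CharacterAt.toFunction_app, ← χ.naturality, map_mul]

/-- The algebra morphism `𝔸_𝔾^* → 𝓡` defined by a character. -/
def CharacterAt.toSpec {S : CommAlgCat.{u} R} (χ : CharacterAt G S) :
    (convolution G).SpecAt S where
  toDual := (functions G.toSet).toBidual S χ.toFunction
  map_mul {T} φ a b := by
    rw [convolution_mul, ModuleFunctor.toBidual_app, ModuleFunctor.toBidual_app,
      ModuleFunctor.toBidual_app, convolve_app, ← CharacterAt.toFunction_restrict,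
      integrate_character, map_smul, (functions G.toSet).dual.map_id, smul_eq_mul, mul_comm]
  map_one {T} φ := by
    change (χ.app (φ ≫ 𝟙 T)) (G.map (𝟙 T) (1 : G.obj T)) = 1
    rw [CommMonFunctor.map_one_apply, map_one]

/-- The character defined by an algebra morphism `𝔸_𝔾^* → 𝓡`. -/
def SpecAt.toCharacter {S : CommAlgCat.{u} R} (p : (convolution G).SpecAt S) :
    CharacterAt G S where
  app {T} φ :=
    { toFun := fun x => p.toDual.app φ (evalMap G.toSet T x)
      map_one' := p.map_one φ
      map_mul' := fun x y => by
        rw [← p.map_mul, ← (extendsMonoid_convolution G T).2] }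
  naturality {T T'} φ ψ x := by
    change p.toDual.app (φ ≫ ψ) (evalMap G.toSet T' (G.toSet.map ψ x)) =
      ψ (p.toDual.app φ (evalMap G.toSet T x))
    rw [← p.toDual.naturality, ← evalMap_map]

/-- Composition with `𝔾 → 𝔸_𝔾^*` identifies `Spec 𝔸_𝔾^*` with `𝔾^∨`. -/
def characterEquiv (h : (functions G.toSet).IsReflexive) (S : CommAlgCat.{u} R) :
    CharacterAt G S ≃ (convolution G).SpecAt S where
  toFun χ := χ.toSpec
  invFun p := SpecAt.toCharacter p
  left_inv χ := CharacterAt.ext_app fun {T} φ => MonoidHom.ext fun x => by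
    change χ.app (φ ≫ 𝟙 T) (G.map (𝟙 T) x) = χ.app φ x
    rw [CommMonFunctor.map_id_apply, Category.comp_id]
  -- Reflexivity is used only here: an algebra morphism must be recovered from its values at points.
  right_inv p := AlgebraStructure.SpecAt.ext <| bidual_ext h fun {T} φ x => by
    change p.toDual.app (φ ≫ 𝟙 T) (evalMap G.toSet T (G.map (𝟙 T) x)) =
      p.toDual.app φ (evalMap G.toSet T x)
    rw [CommMonFunctor.map_id_apply, Category.comp_id]

/-- The dual monoid as a spectrum. -/
def dualPresentation (h : (functions G.toSet).IsReflexive) :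
    SpecPresentation (dualMonoid G).toSet (convolution G) where
  equiv S := characterEquiv h S
  naturality {S _} f (χ : CharacterAt G S) := h.iso.naturality f χ.toFunction

/-- The isomorphism of functors of sets between `Spec 𝔸_𝔾^*` and `𝔾^∨`. -/
def specConvolutionIso (h : (functions G.toSet).IsReflexive) :
    (convolution G).spec ≅ (dualMonoid G).toSet :=
  NatIso.ofComponents (fun S => (characterEquiv h S).symm.toIso) (fun _ => rfl)

lemma specConvolutionIso_hom_app (h : (functions G.toSet).IsReflexive) {S T : CommAlgCat.{u} R}
    (p : (convolution G).SpecAt S) (φ : S ⟶ T) (g : G.obj T) :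
    CharacterAt.app ((specConvolutionIso h).hom.app S p) φ g =
      p.toDual.app φ (evalMap G.toSet T g) := rfl

end Convolution

/-! ### Quasi-coherent modules and their duals -/

section QuasiCoherent

variable {C : Type u} [AddCommGroup C] [Module R C] {I : Type u} (b : Module.Basis I R C)

lemma quasiCoherent_map_tmul {S T : CommAlgCat.{u} R} (φ : S ⟶ T) (s : S) (c : C) :
    (quasiCoherent R C).map φ (s ⊗ₜ[R] c) = φ s ⊗ₜ[R] c := rfl

/-- The linear function on `𝓒_{|S}` with given values on `C`. -/
def dualOfLinearMap {S : CommAlgCat.{u} R} (g : C →ₗ[R] S) : DualAt (quasiCoherent R C) S where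
  app {T} φ := LinearMap.liftBaseChange T (φ.hom.toLinearMap ∘ₗ g)
  naturality {T T'} φ ψ x := by
    change T ⊗[R] C at x
    induction x with
    | zero => simp
    | tmul t c =>
      rw [quasiCoherent_map_tmul, LinearMap.liftBaseChange_tmul, LinearMap.liftBaseChange_tmul]
      simp
    | add x y hx hy => rw [map_add, map_add, hx, hy, map_add, map_add]

lemma dualOfLinearMap_app_tmul {S T : CommAlgCat.{u} R} (g : C →ₗ[R] S) (φ : S ⟶ T) (t : T)
    (c : C) : (dualOfLinearMap g).app φ (t ⊗ₜ[R] c) = t * φ (g c) :=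
  LinearMap.liftBaseChange_tmul _ _ _ _

/-- Linearity and naturality reduce everything to the elements `1 ⊗ c` over `S`, so that `𝓒^*(S)` is
`Hom_R(C, S)`. -/
lemma DualAt.app_tmul {S T : CommAlgCat.{u} R} (a : DualAt (quasiCoherent R C) S) (φ : S ⟶ T)
    (t : T) (c : C) : a.app φ (t ⊗ₜ[R] c) = t * φ (a.app (𝟙 S) ((1 : S) ⊗ₜ[R] c)) := by
  rw [← DualAt.app_map, quasiCoherent_map_tmul, map_one, ← smul_eq_mul, ← map_smul,
    TensorProduct.smul_tmul', smul_eq_mul, mul_one]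

/-- The coordinates of a linear function on `𝓒` with respect to a basis of `C`. -/
def coord (S : CommAlgCat.{u} R) (i : I) : DualAt (quasiCoherent R C) S →ₗ[S] S where
  toFun a := a.app (𝟙 S) ((1 : S) ⊗ₜ[R] b i)
  map_add' _ _ := rfl
  map_smul' s a := by rw [DualAt.smul_app, CommAlgCat.id_apply]; rfl

lemma coord_apply {S : CommAlgCat.{u} R} (i : I) (a : DualAt (quasiCoherent R C) S) :
    coord b S i a = a.app (𝟙 S) ((1 : S) ⊗ₜ[R] b i) := rfl

lemma coord_map {S T : CommAlgCat.{u} R} (φ : S ⟶ T) (i : I)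
    (a : DualAt (quasiCoherent R C) S) :
    coord b T i ((quasiCoherent R C).dual.map φ a) = φ (coord b S i a) := by
  rw [coord_apply, coord_apply, ModuleFunctor.dual_map_app, Category.comp_id, DualAt.app_tmul,
    one_mul]

lemma dual_ext_coord {S : CommAlgCat.{u} R} {a a' : DualAt (quasiCoherent R C) S}
    (h : ∀ i, coord b S i a = coord b S i a') : a = a' := by
  refine DualAt.ext_app fun {T} φ => (b.baseChange T).ext fun i => ?_
  rw [Module.Basis.baseChange_apply, DualAt.app_tmul, DualAt.app_tmul a']
  exact congrArg (fun s => 1 * φ s) (h i)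

/-- The linear function on `𝓒` with given coordinates. -/
def dualOfCoords {S : CommAlgCat.{u} R} (g : I → S) : DualAt (quasiCoherent R C) S :=
  dualOfLinearMap (b.constr R g)

lemma coord_dualOfCoords {S : CommAlgCat.{u} R} (g : I → S) (i : I) :
    coord b S i (dualOfCoords b g) = g i := by
  rw [coord_apply, dualOfCoords, dualOfLinearMap_app_tmul, Module.Basis.constr_basis, one_mul,
    CommAlgCat.id_apply]

open Classical in
/-- The dual basis of a basis of `C`. -/
def dualBasis (S : CommAlgCat.{u} R) (i : I) : DualAt (quasiCoherent R C) S :=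
  dualOfCoords b (Pi.single i 1)

open Classical in
lemma coord_dualBasis (S : CommAlgCat.{u} R) (i j : I) :
    coord b S j (dualBasis b S i) = if j = i then 1 else 0 := by
  rw [dualBasis, coord_dualOfCoords, Pi.single_apply]

lemma dualBasis_map {S T : CommAlgCat.{u} R} (φ : S ⟶ T) (i : I) :
    (quasiCoherent R C).dual.map φ (dualBasis b S i) = dualBasis b T i := by
  classical
  refine dual_ext_coord b fun j => ?_
  rw [coord_map, coord_dualBasis, coord_dualBasis]
  split_ifs <;> simp

/-- The part of a linear function on `𝓒` supported on a finite set of basis elements. -/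
def truncate (J : Finset I) {S : CommAlgCat.{u} R} (a : DualAt (quasiCoherent R C) S) :
    DualAt (quasiCoherent R C) S :=
  ∑ j ∈ J, coord b S j a • dualBasis b S j

lemma coord_truncate {J : Finset I} {S : CommAlgCat.{u} R} (a : DualAt (quasiCoherent R C) S)
    {i : I} (hi : i ∈ J) : coord b S i (truncate b J a) = coord b S i a := by
  classical
  simp only [truncate, map_sum, map_smul, coord_dualBasis, smul_eq_mul, mul_ite, mul_one,
    mul_zero, Finset.sum_ite_eq, if_pos hi]

/-- The universal linear function on `𝓒`, over a polynomial ring, specializes to any other. -/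
lemma exists_specialization {S T : CommAlgCat.{u} R} (φ : S ⟶ T)
    (a : DualAt (quasiCoherent R C) T) :
    ∃ g : CommAlgCat.of R (MvPolynomial I S) ⟶ T,
      CommAlgCat.ofHom (IsScalarTower.toAlgHom R S (MvPolynomial I S)) ≫ g = φ ∧
      (∀ p : MvPolynomial I S, g p = MvPolynomial.eval₂ φ.hom.toRingHom
        (fun i => coord b T i a) p) ∧
      (quasiCoherent R C).dual.map g
        (dualOfCoords b (S := CommAlgCat.of R (MvPolynomial I S)) MvPolynomial.X) = a := by
  let g₀ : MvPolynomial I S →ₐ[R] T :=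
    { MvPolynomial.eval₂Hom φ.hom.toRingHom (fun i => coord b T i a) with
      commutes' := fun r => by
        change MvPolynomial.eval₂ _ _ (algebraMap R (MvPolynomial I S) r) = _
        rw [MvPolynomial.algebraMap_apply, MvPolynomial.eval₂_C]
        exact φ.hom.commutes r }
  refine ⟨CommAlgCat.ofHom g₀, ?_, fun p => rfl, ?_⟩
  · ext s
    exact MvPolynomial.eval₂_C _ _ s
  · refine dual_ext_coord b fun i => ?_
    rw [coord_map, coord_dualOfCoords]
    exact MvPolynomial.eval₂_X _ _ i

/-- A linear function on `𝓒^*` depends on finitely many coordinates. -/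
lemma exists_finite_support {S : CommAlgCat.{u} R} (F : DualAt (quasiCoherent R C).dual S) :
    ∃ J : Finset I, ∀ {T : CommAlgCat.{u} R} (φ : S ⟶ T) (a a' : DualAt (quasiCoherent R C) T),
      (∀ j ∈ J, coord b T j a = coord b T j a') → F.app φ a = F.app φ a' := by
  classical
  let T₀ := CommAlgCat.of R (MvPolynomial I S)
  let ι : S ⟶ T₀ := CommAlgCat.ofHom (IsScalarTower.toAlgHom R S (MvPolynomial I S))
  -- The value of `F` at the universal linear function. Naturality makes `F(a)` the value of `p` at
  -- the coordinates of `a`, so the variables of `p` are a support for `F`.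
  let p : MvPolynomial I S := F.app ι (dualOfCoords b (S := T₀) MvPolynomial.X)
  have key : ∀ {T : CommAlgCat.{u} R} (φ : S ⟶ T) (a : DualAt (quasiCoherent R C) T),
      F.app φ a = MvPolynomial.eval₂ φ.hom.toRingHom (fun i => coord b T i a) p := by
    intro T φ a
    obtain ⟨g, hg, hp, ha⟩ := exists_specialization b φ a
    rw [← hp, ← F.naturality ι g, hg, ha]
  refine ⟨p.vars, fun {T} φ a a' h => ?_⟩
  rw [key, key]
  exact MvPolynomial.eval₂Hom_congr' rfl (fun i hi _ => h i hi) rfl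

/-- A linear function on `𝓒^*` is a finite sum of coordinates. -/
lemma app_eq_app_truncate {S : CommAlgCat.{u} R} {F : DualAt (quasiCoherent R C).dual S}
    {J : Finset I} (hJ : ∀ {T : CommAlgCat.{u} R} (φ : S ⟶ T)
      (a a' : DualAt (quasiCoherent R C) T),
      (∀ j ∈ J, coord b T j a = coord b T j a') → F.app φ a = F.app φ a')
    {T : CommAlgCat.{u} R} (φ : S ⟶ T) (a : DualAt (quasiCoherent R C) T) :
    F.app φ a = ∑ j ∈ J, coord b T j a * φ (F.app (𝟙 S) (dualBasis b S j)) := by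
  rw [hJ φ a (truncate b J a) fun j hj => (coord_truncate b a hj).symm, truncate, map_sum]
  refine Finset.sum_congr rfl fun j _ => ?_
  rw [map_smul, smul_eq_mul, ← DualAt.app_map, dualBasis_map]

lemma dualBasis_app (S : CommAlgCat.{u} R) (i : I) (x : S ⊗[R] C) :
    (dualBasis b S i).app (𝟙 S) x = (b.baseChange S).repr x i := by
  classical
  have : (dualBasis b S i).app (𝟙 S) = (b.baseChange S).coord i := by
    refine (b.baseChange S).ext fun j => ?_
    rw [Module.Basis.coord_apply, Module.Basis.repr_self, Module.Basis.baseChange_apply,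
      ← coord_apply, coord_dualBasis, Finsupp.single_apply]
  exact LinearMap.congr_fun this x

include b in
-- The dual basis separates the elements of `S ⊗ C`, and a linear function `F` on `𝓒^*` with finite
-- support `J` comes from the finite sum of the `F(e_j^*) ⊗ e_j` for `j ∈ J`.
lemma quasiCoherent_isReflexive : (quasiCoherent R C).IsReflexive := by
  refine fun S => ⟨fun x y hxy => ?_, fun F => ?_⟩
  · refine (b.baseChange S).ext_elem fun i => ?_
    rw [← dualBasis_app, ← dualBasis_app]
    have := congrArg (fun F : DualAt (quasiCoherent R C).dual S =>
      F.app (𝟙 S) (dualBasis b S i)) hxy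
    change (dualBasis b S i).app (𝟙 S) ((quasiCoherent R C).map (𝟙 S) x) =
      (dualBasis b S i).app (𝟙 S) ((quasiCoherent R C).map (𝟙 S) y) at this
    rwa [(quasiCoherent R C).map_id, (quasiCoherent R C).map_id] at this
  · obtain ⟨J, hJ⟩ := exists_finite_support b F
    refine ⟨∑ j ∈ J, F.app (𝟙 S) (dualBasis b S j) ⊗ₜ[R] b j, ?_⟩
    refine DualAt.ext_app fun {T} φ => LinearMap.ext fun (a : DualAt (quasiCoherent R C) T) => ?_
    rw [app_eq_app_truncate b hJ, ModuleFunctor.toBidual_app, map_sum, map_sum]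
    refine Finset.sum_congr rfl fun j _ => ?_
    rw [quasiCoherent_map_tmul, DualAt.app_tmul, CommAlgCat.id_apply, mul_comm, coord_apply]

end QuasiCoherent

/-! ### Points of spectra over quotients -/

section Points

variable {M : ModuleFunctor.{w} R} {A : AlgebraStructure M}

/-- Algebra morphisms `𝔸(S) → T` over a morphism `φ : S ⟶ T`. -/
structure AlgebraStructure.HomOver (A : AlgebraStructure M) {S T : CommAlgCat.{u} R}
    (φ : S ⟶ T) where
  hom : M.obj S →+ T
  hom_mul : ∀ x y, hom (A.mul S x y) = hom x * hom y
  hom_one : hom (A.one S) = 1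
  hom_smul : ∀ (s : S) x, hom (s • x) = φ s * hom x

/-- The morphism of algebras defined by a point of the spectrum. -/
def AlgebraStructure.SpecAt.homOver {S T : CommAlgCat.{u} R} (p : A.SpecAt T) (φ : S ⟶ T) :
    A.HomOver φ where
  hom := (p.toDual.app (𝟙 T)).toAddMonoidHom.comp (M.map φ)
  hom_mul x y := by
    change p.toDual.app (𝟙 T) (M.map φ _) = _
    rw [A.map_mul, p.map_mul]
    rfl
  hom_one := by
    change p.toDual.app (𝟙 T) (M.map φ _) = _
    rw [A.map_one, p.map_one]
  hom_smul s x := by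
    change p.toDual.app (𝟙 T) (M.map φ _) = _
    rw [M.map_smul, map_smul]
    rfl

lemma AlgebraStructure.SpecAt.homOver_apply {S T : CommAlgCat.{u} R} (p : A.SpecAt T)
    (φ : S ⟶ T) (x : M.obj S) :
    (p.homOver φ).hom x = p.toDual.app (𝟙 T) (M.map φ x) := rfl

/-- The commutative ring `𝔸(S)` of a functor of commutative algebras. -/
def AlgebraStructure.IsComm.Carrier (_ : A.IsComm) (S : CommAlgCat.{u} R) : Type w := M.obj S

instance (hA : A.IsComm) (S : CommAlgCat.{u} R) : AddCommGroup (hA.Carrier S) :=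
  inferInstanceAs (AddCommGroup (M.obj S))

instance (hA : A.IsComm) (S : CommAlgCat.{u} R) : CommRing (hA.Carrier S) :=
  { (inferInstance : AddCommGroup (hA.Carrier S)) with
    mul := fun x y => A.mul S x y
    one := A.one S
    mul_assoc := A.mul_assoc S
    one_mul := A.one_mul S
    mul_one := A.mul_one S
    mul_comm := hA S
    left_distrib := fun x y z => map_add (A.mul S x) y z
    right_distrib := fun x y z => LinearMap.map_add₂ (A.mul S) x y z
    zero_mul := fun x => LinearMap.map_zero₂ (A.mul S) x
    mul_zero := fun x => map_zero (A.mul S x) }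

/-- The structural morphism `S → 𝔸(S)`. -/
def AlgebraStructure.IsComm.structureMap (hA : A.IsComm) (S : CommAlgCat.{u} R) :
    S →+* hA.Carrier S where
  toFun s := (s • A.one S : M.obj S)
  map_one' := one_smul S (A.one S)
  map_mul' s t := by
    change (s * t) • A.one S = A.mul S (s • A.one S) (t • A.one S)
    rw [map_smul, LinearMap.map_smul₂, A.mul_one, smul_smul, mul_comm]
  map_zero' := zero_smul S (A.one S)
  map_add' s t := add_smul s t (A.one S)

lemma AlgebraStructure.IsComm.structureMap_mul (hA : A.IsComm) (S : CommAlgCat.{u} R) (s : S)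
    (x : M.obj S) : A.mul S (hA.structureMap S s) x = s • x := by
  change A.mul S (s • A.one S) x = s • x
  rw [LinearMap.map_smul₂, A.one_mul]

/-- A small commutative ring under `S` is isomorphic to a commutative `R`-algebra of the base
universe. -/
lemma exists_commAlgCat {S : CommAlgCat.{u} R} {B : Type w} [CommRing B] [Small.{u} B]
    (f : S →+* B) :
    ∃ (T : CommAlgCat.{u} R) (φ : S ⟶ T) (e : T ≃+* B), ∀ s, e (φ s) = f s := by
  let g : S →+* Shrink.{u} B := (Shrink.ringEquiv B).symm.toRingHom.comp f
  let _ : Algebra R (Shrink.{u} B) := (g.comp (algebraMap R S)).toAlgebra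
  refine ⟨CommAlgCat.of R (Shrink.{u} B), CommAlgCat.ofHom { g with commutes' := fun _ => rfl },
    Shrink.ringEquiv B, fun s => ?_⟩
  exact (Shrink.ringEquiv B).apply_symm_apply (f s)

/-- The quotient of `𝔸(S)` by the ideal generated by a subset. -/
lemma AlgebraStructure.IsComm.exists_quotient (hA : A.IsComm) (S : CommAlgCat.{u} R)
    [Small.{u} (M.obj S)] (N : Set (M.obj S)) :
    ∃ (T : CommAlgCat.{u} R) (φ : S ⟶ T) (π : A.HomOver φ),
      Function.Surjective π.hom ∧ (∀ n ∈ N, π.hom n = 0) ∧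
      (∀ {T' : CommAlgCat.{u} R} {ψ : S ⟶ T'} (h : A.HomOver ψ), (∀ n ∈ N, h.hom n = 0) →
        ∃ g : T ⟶ T', φ ≫ g = ψ ∧ ∀ x, g (π.hom x) = h.hom x) ∧
      ∀ x, π.hom x = 0 → x ∈ AddSubgroup.closure {z | ∃ y, ∃ n ∈ N, z = A.mul S y n} := by
  let a : Ideal (hA.Carrier S) := Ideal.span N
  have : Small.{u} (hA.Carrier S) := (inferInstance : Small.{u} (M.obj S))
  -- The quotient must have a model in the universe `u` to serve as a test algebra for the functors.
  have : Small.{u} (hA.Carrier S ⧸ a) := small_of_surjective Ideal.Quotient.mk_surjective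
  obtain ⟨T, φ, e, he⟩ := exists_commAlgCat ((Ideal.Quotient.mk a).comp (hA.structureMap S))
  let q : hA.Carrier S →+* T := e.symm.toRingHom.comp (Ideal.Quotient.mk a)
  have hq : ∀ s, q (hA.structureMap S s) = φ s := fun s => by
    change e.symm (Ideal.Quotient.mk a (hA.structureMap S s)) = φ s
    rw [RingEquiv.symm_apply_eq, he]
    rfl
  have hq0 : ∀ x, q x = 0 ↔ x ∈ a := fun x => by
    change e.symm (Ideal.Quotient.mk a x) = 0 ↔ _
    rw [map_eq_zero_iff e.symm e.symm.injective, Ideal.Quotient.eq_zero_iff_mem]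
  have hsurj : Function.Surjective q :=
    e.symm.surjective.comp Ideal.Quotient.mk_surjective
  -- An additive description of the ideal generated by `N`: it allows a condition on products with
  -- elements of `N` to be checked on generators by an additive map, such as a coordinate.
  let K : AddSubgroup (M.obj S) := AddSubgroup.closure {z | ∃ y, ∃ n ∈ N, z = A.mul S y n}
  have hK : ∀ (r z : M.obj S), z ∈ K → A.mul S r z ∈ K := by
    intro r z hz
    refine (AddSubgroup.closure_le (K.comap (A.mul S r).toAddMonoidHom)).2 ?_ hz
    rintro _ ⟨y, n, hn, rfl⟩
    exact AddSubgroup.subset_closure ⟨A.mul S r y, n, hn, (A.mul_assoc S r y n).symm⟩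
  let b : Ideal (hA.Carrier S) :=
    { carrier := (K : Set (M.obj S))
      add_mem' := K.add_mem
      zero_mem' := K.zero_mem
      smul_mem' := hK }
  have hab : a ≤ b := Ideal.span_le.2 fun n hn =>
    AddSubgroup.subset_closure ⟨A.one S, n, hn, (A.one_mul S n).symm⟩
  refine ⟨T, φ, ⟨⟨⟨q, q.map_zero⟩, q.map_add⟩, q.map_mul, q.map_one, fun s x => ?_⟩, hsurj,
    fun n hn => (hq0 n).2 (Ideal.subset_span hn), fun {T' ψ} h hN => ?_,
    fun x hx => hab ((hq0 x).1 hx)⟩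
  · rw [← hq]
    exact (congrArg q (hA.structureMap_mul S s x).symm).trans (_root_.map_mul q _ _)
  · let h' : hA.Carrier S →+* T' :=
      { toFun := fun x => h.hom x
        map_one' := h.hom_one
        map_mul' := h.hom_mul
        map_zero' := h.hom.map_zero
        map_add' := h.hom.map_add }
    have ha : ∀ x ∈ a, h' x = 0 := fun x hx =>
      (Ideal.span_le (I := RingHom.ker h')).2 (fun n hn => hN n hn) hx
    let g₀ : T →+* T' := (Ideal.Quotient.lift a h' ha).comp e.toRingHom
    have hg : ∀ x, g₀ (q x) = h' x := fun x => by
      change Ideal.Quotient.lift a h' ha (e (e.symm (Ideal.Quotient.mk a x))) = _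
      rw [RingEquiv.apply_symm_apply, Ideal.Quotient.lift_mk]
    have hgφ : ∀ s, g₀ (φ s) = ψ s := fun s => by
      rw [← hq, hg]
      change h.hom (s • A.one S) = ψ s
      rw [h.hom_smul, h.hom_one, _root_.mul_one]
    refine ⟨CommAlgCat.ofHom { g₀ with commutes' := fun r => ?_ }, ?_, hg⟩
    · change g₀ (algebraMap R T r) = _
      rw [← φ.hom.commutes r]
      exact (hgφ _).trans (ψ.hom.commutes r)
    · ext s
      exact hgφ s

/-- A linear function that is given by a morphism of algebras `h : 𝔸(S) → T` on the elements that
come from `S` is multiplicative on their span. -/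
lemma AlgebraStructure.HomOver.map_mul_of_mem_span {S T T' : CommAlgCat.{u} R} {φ : S ⟶ T}
    (h : A.HomOver φ) (ψ : T ⟶ T') (L : M.obj T' →ₗ[T'] T')
    (hL : ∀ x, L (M.map (φ ≫ ψ) x) = ψ (h.hom x)) {x y : M.obj T'}
    (hx : x ∈ Submodule.span T' (Set.range (M.map (φ ≫ ψ))))
    (hy : y ∈ Submodule.span T' (Set.range (M.map (φ ≫ ψ)))) :
    L (A.mul T' x y) = L x * L y := by
  induction hx using Submodule.span_induction with
  | zero => simp
  | add x x' _ _ hx hx' => simp [hx, hx', add_mul]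
  | smul t x _ hx => simp [hx, _root_.mul_assoc]
  | mem x hx =>
    obtain ⟨x, rfl⟩ := hx
    induction hy using Submodule.span_induction with
    | zero => simp
    | add y y' _ _ hy hy' => simp [hy, hy', mul_add]
    | smul t y _ hy => simp [hy, mul_left_comm]
    | mem y hy =>
      obtain ⟨y, rfl⟩ := hy
      rw [← A.map_mul, hL, hL, hL, h.hom_mul, _root_.map_mul]

end Points

/-! ### Functions on spectra -/

/-- If the morphisms of algebras from `𝔸(S)` that vanish on `N` are points of the spectrum, then
there is a universal one, and a function on the spectrum is, at all of these points, equal to an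
element of `𝔸(S)`. -/
lemma AlgebraStructure.IsComm.exists_universal_point {M : ModuleFunctor.{w} R}
    {A : AlgebraStructure M} (hA : A.IsComm) {S : CommAlgCat.{u} R} [Small.{u} (M.obj S)]
    (N : Set (M.obj S))
    (huniq : ∀ {T : CommAlgCat.{u} R} (φ : S ⟶ T) (p p' : A.SpecAt T),
      (∀ x, p.toDual.app (𝟙 T) (M.map φ x) = p'.toDual.app (𝟙 T) (M.map φ x)) → p = p')
    (hex : ∀ {T : CommAlgCat.{u} R} (φ : S ⟶ T) (h : A.HomOver φ), (∀ n ∈ N, h.hom n = 0) →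
      ∃ p : A.SpecAt T, ∀ x, p.toDual.app (𝟙 T) (M.map φ x) = h.hom x) :
    ∃ (T : CommAlgCat.{u} R) (φ : S ⟶ T) (p : A.SpecAt T),
      (∀ n ∈ N, p.toDual.app (𝟙 T) (M.map φ n) = 0) ∧
      (∀ x, p.toDual.app (𝟙 T) (M.map φ x) = 0 →
        x ∈ AddSubgroup.closure {z | ∃ y, ∃ n ∈ N, z = A.mul S y n}) ∧
      ∀ f : FunctionAt A.spec S, ∃ x : M.obj S, ∀ {T' : CommAlgCat.{u} R} (ψ : S ⟶ T')
        (q : A.SpecAt T'), (∀ n ∈ N, q.toDual.app (𝟙 T') (M.map ψ n) = 0) →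
          f.app ψ q = q.toDual.app (𝟙 T') (M.map ψ x) := by
  obtain ⟨T, φ, π, hsurj, hN, huniv, hker⟩ := hA.exists_quotient S N
  obtain ⟨p, hp⟩ := hex φ π hN
  refine ⟨T, φ, p, fun n hn => (hp n).trans (hN n hn),
    fun x hx => hker x ((hp x).symm.trans hx), fun f => ?_⟩
  -- The Yoneda argument: `x` lifts the value of `f` at the universal point `p`. A point `q`
  -- vanishing on `N` is the image of `p` under some `g`, so `f(q) = g(f(p)) = q(x)`.
  obtain ⟨x, hx⟩ := hsurj (f.app φ p)
  refine ⟨x, fun {T'} ψ q hq => ?_⟩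
  obtain ⟨g, rfl, hg⟩ := huniv (q.homOver ψ) hq
  have hqp : q = A.spec.map g p := by
    refine huniq (φ ≫ g) _ _ fun y => ?_
    change (q.homOver (φ ≫ g)).hom y = p.toDual.app (g ≫ 𝟙 T') (M.map (φ ≫ g) y)
    rw [← hg, ← hp, ← p.toDual.naturality, M.map_comp, Category.comp_id, Category.id_comp]
  rw [← q.homOver_apply, ← hg, hx, hqp]
  exact f.naturality φ g p

/-! ### Functions on the spectrum of a quasi-coherent algebra -/

section QuasiCoherent

variable {C : Type u} [AddCommGroup C] [Module R C]

lemma quasiCoherent_dual_ext {S T : CommAlgCat.{u} R} (φ : S ⟶ T)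
    {a a' : DualAt (quasiCoherent R C) T}
    (h : ∀ x, a.app (𝟙 T) ((quasiCoherent R C).map φ x) =
      a'.app (𝟙 T) ((quasiCoherent R C).map φ x)) : a = a' := by
  refine DualAt.ext_app fun {T'} ψ => LinearMap.ext fun x => ?_
  change T' ⊗[R] C at x
  induction x with
  | zero => rw [map_zero, map_zero]
  | tmul t c =>
    rw [DualAt.app_tmul a, DualAt.app_tmul a']
    have := h ((1 : S) ⊗ₜ[R] c)
    rw [quasiCoherent_map_tmul, map_one] at this
    rw [this]
  | add x y hx hy => rw [map_add, map_add, hx, hy]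

lemma quasiCoherent_span_range_map {S T : CommAlgCat.{u} R} (φ : S ⟶ T) (x : T ⊗[R] C) :
    x ∈ Submodule.span T (Set.range ((quasiCoherent R C).map φ)) := by
  induction x with
  | zero => exact Submodule.zero_mem _
  | tmul t c =>
    have : t ⊗ₜ[R] c = t • (quasiCoherent R C).map φ ((1 : S) ⊗ₜ[R] c) := by
      rw [quasiCoherent_map_tmul, map_one, TensorProduct.smul_tmul', smul_eq_mul, mul_one]
    rw [this]
    exact Submodule.smul_mem _ _ (Submodule.subset_span ⟨_, rfl⟩)
  | add x y hx hy => exact Submodule.add_mem _ hx hy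

/-- The values of `h` on `1 ⊗ c` define a linear function on `𝓒_{|T}`. It is multiplicative because
`T' ⊗ C` is spanned by the image of `S ⊗ C`, where it is given by `h`. -/
lemma quasiCoherent_exists_point {A : AlgebraStructure (quasiCoherent R C)}
    {S T : CommAlgCat.{u} R} (φ : S ⟶ T) (h : A.HomOver φ) :
    ∃ p : A.SpecAt T, ∀ x, p.toDual.app (𝟙 T) ((quasiCoherent R C).map φ x) = h.hom x := by
  let g : C →ₗ[R] T :=
    { toFun := fun c => h.hom ((1 : S) ⊗ₜ[R] c)
      map_add' := fun c c' => by rw [TensorProduct.tmul_add, map_add]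
      map_smul' := fun r c => by
        rw [RingHom.id_apply, ← TensorProduct.smul_tmul, ← mul_one (r • (1 : S)), ← smul_eq_mul,
          ← TensorProduct.smul_tmul', h.hom_smul, Algebra.smul_def, mul_one, Algebra.smul_def]
        exact congrArg (· * _) (φ.hom.commutes r) }
  have key : ∀ {T' : CommAlgCat.{u} R} (ψ : T ⟶ T') (x : S ⊗[R] C),
      (dualOfLinearMap g).app ψ ((quasiCoherent R C).map (φ ≫ ψ) x) = ψ (h.hom x) := by
    intro T' ψ x
    induction x with
    | zero => simp only [map_zero]
    | tmul s c =>
      rw [quasiCoherent_map_tmul, dualOfLinearMap_app_tmul, CommAlgCat.comp_apply, ← map_mul]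
      refine congrArg ψ ?_
      change φ s * h.hom ((1 : S) ⊗ₜ[R] c) = _
      rw [← h.hom_smul, TensorProduct.smul_tmul', smul_eq_mul, mul_one]
    | add x y hx hy => rw [map_add, map_add, hx, hy, map_add, map_add]
  refine ⟨⟨dualOfLinearMap g, fun {T'} ψ x y => ?_, fun {T'} ψ => ?_⟩, fun x => ?_⟩
  · exact h.map_mul_of_mem_span ψ _ (key ψ) (quasiCoherent_span_range_map _ x)
      (quasiCoherent_span_range_map _ y)
  · rw [← A.map_one (φ ≫ ψ), key, h.hom_one, map_one]
  · have := key (𝟙 T) x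
    rwa [Category.comp_id, CommAlgCat.id_apply] at this

/-- With `N` empty, no quotient is taken: the ring `𝔸(S)` itself carries a universal point, whose
values separate elements and through which every function factors. -/
lemma quasiCoherent_isFunctional [Module.Free R C] : (quasiCoherent R C).IsFunctional := by
  refine ⟨quasiCoherent_isReflexive (Module.Free.chooseBasis R C), fun A hA S => ?_⟩
  obtain ⟨T, φ, p, -, hker, hrep⟩ := hA.exists_universal_point (S := S) ∅
    (fun φ p p' h => AlgebraStructure.SpecAt.ext (quasiCoherent_dual_ext φ h))
    (fun φ h _ => quasiCoherent_exists_point φ h)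
  refine ⟨fun x y hxy => ?_, fun f => ?_⟩
  · have h₁ : p.toDual.app (𝟙 T) ((quasiCoherent R C).map φ x) =
        p.toDual.app (𝟙 T) ((quasiCoherent R C).map φ y) :=
      congrArg (fun f : FunctionAt A.spec S => f.app φ p) hxy
    have h₂ := hker (x - y) (by rw [map_sub, map_sub, h₁, sub_self])
    simpa [sub_eq_zero] using h₂
  · obtain ⟨x, hx⟩ := hrep f
    exact ⟨x, FunctionAt.ext_app fun ψ q => (hx ψ q (by simp)).symm⟩

end QuasiCoherent

/-! ### Functions on the spectrum of a dual of a free module -/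

section Formal

variable {C : Type u} [AddCommGroup C] [Module R C] {I : Type u} (b : Module.Basis I R C)
  {A : AlgebraStructure (quasiCoherent R C).dual}

include b in
-- The difference is a finite combination of coordinates whose coefficients are its values on the
-- dual basis, and the dual basis already comes from `S`.
lemma dual_dual_ext {S T : CommAlgCat.{u} R} (φ : S ⟶ T)
    {F F' : DualAt (quasiCoherent R C).dual T}
    (h : ∀ x, F.app (𝟙 T) ((quasiCoherent R C).dual.map φ x) =
      F'.app (𝟙 T) ((quasiCoherent R C).dual.map φ x)) : F = F' := by
  obtain ⟨J, hJ⟩ := exists_finite_support b (F - F')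
  rw [← sub_eq_zero]
  refine DualAt.ext_app fun {T'} ψ => LinearMap.ext fun a => ?_
  rw [app_eq_app_truncate b hJ]
  refine Finset.sum_eq_zero fun j _ => ?_
  have : (F - F').app (𝟙 T) (dualBasis b T j) = 0 := by
    rw [← dualBasis_map b φ, sub_eq_add_neg, DualAt.add_app, LinearMap.add_apply, h,
      DualAt.neg_app, LinearMap.neg_apply, add_neg_cancel]
  rw [this, map_zero, mul_zero]

/-- A coordinate of a product depends on finitely many coordinates of the second factor. -/
lemma exists_finset_coord_mul (A : AlgebraStructure (quasiCoherent R C).dual) (j : I) :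
    ∃ K : Finset I, ∀ {T : CommAlgCat.{u} R} (x y y' : DualAt (quasiCoherent R C) T),
      (∀ k ∈ K, coord b T k y = coord b T k y') →
        coord b T j (A.mul T x y) = coord b T j (A.mul T x y') := by
  let R₀ := CommAlgCat.of R R
  let T₀ := CommAlgCat.of R (MvPolynomial I R₀)
  -- Taking the first factor universal makes the finite set `K` independent of `x` and of `T`: every
  -- `x` is a specialization of `W`.
  let W : DualAt (quasiCoherent R C) T₀ := dualOfCoords b (S := T₀) MvPolynomial.X
  let F : DualAt (quasiCoherent R C).dual T₀ :=
    ⟨fun {T} ψ => coord b T j ∘ₗ A.mul T ((quasiCoherent R C).dual.map ψ W),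
      fun {T T'} φ ψ x => by
        rw [LinearMap.comp_apply, LinearMap.comp_apply, (quasiCoherent R C).dual.map_comp,
          ← A.map_mul, coord_map]⟩
  obtain ⟨K, hK⟩ := exists_finite_support b F
  refine ⟨K, fun {T} x y y' h => ?_⟩
  obtain ⟨g, -, -, hg⟩ := exists_specialization b
    (CommAlgCat.ofHom (Algebra.ofId R T) : R₀ ⟶ T) x
  have := hK g y y' h
  change coord b T j (A.mul T ((quasiCoherent R C).dual.map g W) y) =
    coord b T j (A.mul T ((quasiCoherent R C).dual.map g W) y') at this
  rwa [hg] at this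

/-- A morphism factoring through the coordinates in `J` extends to the finite sum `∑ h(e_j^*) ·
coord_j`. The coordinates in `J` of a product see only finitely many coordinates of each factor, so
multiplicativity can be tested on truncations, which lie in the span of the image of `𝓒^*(S)`. -/
lemma formal_exists_point (hA : A.IsComm) (J : Finset I) {S T : CommAlgCat.{u} R} (φ : S ⟶ T)
    (h : A.HomOver φ)
    (hJ : ∀ x : DualAt (quasiCoherent R C) S, (∀ j ∈ J, coord b S j x = 0) → h.hom x = 0) :
    ∃ p : A.SpecAt T, ∀ x, p.toDual.app (𝟙 T) ((quasiCoherent R C).dual.map φ x) = h.hom x := by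
  classical
  let F : DualAt (quasiCoherent R C).dual T :=
    ⟨fun {T'} ψ => ∑ j ∈ J, ψ (h.hom (dualBasis b S j)) • coord b T' j,
      fun {T' T''} ψ χ x => by
        simp only [LinearMap.sum_apply, LinearMap.smul_apply, smul_eq_mul, map_sum, map_mul,
          CommAlgCat.comp_apply]
        exact Finset.sum_congr rfl fun j _ => congrArg _ (coord_map b χ j x)⟩
  have hF : ∀ {T' : CommAlgCat.{u} R} (ψ : T ⟶ T') (x : DualAt (quasiCoherent R C) T'),
      F.app ψ x = ∑ j ∈ J, ψ (h.hom (dualBasis b S j)) * coord b T' j x := by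
    intro T' ψ x
    change (∑ j ∈ J, ψ (h.hom (dualBasis b S j)) • coord b T' j) x = _
    simp only [LinearMap.sum_apply, LinearMap.smul_apply, smul_eq_mul]
  have hFcongr : ∀ {T' : CommAlgCat.{u} R} (ψ : T ⟶ T') (x y : DualAt (quasiCoherent R C) T'),
      (∀ j ∈ J, coord b T' j x = coord b T' j y) → F.app ψ x = F.app ψ y := by
    intro T' ψ x y hxy
    rw [hF, hF]
    exact Finset.sum_congr rfl fun j hj => by rw [hxy j hj]
  have key : ∀ {T' : CommAlgCat.{u} R} (ψ : T ⟶ T') (x : DualAt (quasiCoherent R C) S),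
      F.app ψ ((quasiCoherent R C).dual.map (φ ≫ ψ) x) = ψ (h.hom x) := by
    intro T' ψ x
    -- The hypothesis on `h` kills `x - truncate b J x`, whose coordinates in `J` vanish.
    have hx : h.hom x = h.hom (truncate b J x) := by
      rw [← sub_eq_zero, ← map_sub]
      refine hJ _ fun j hj => ?_
      rw [map_sub, coord_truncate b x hj, sub_self]
    rw [hF, hx, truncate, map_sum, map_sum]
    refine Finset.sum_congr rfl fun j _ => ?_
    rw [h.hom_smul, coord_map, map_mul, mul_comm, CommAlgCat.comp_apply]
  choose K hK using exists_finset_coord_mul b A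
  -- `J'` contains `J`, so that truncation to `J'` does not change `F`, and every `K j` with `j ∈
  -- J`, so that it does not change the coordinates in `J` of products.
  let J' : Finset I := J ∪ J.biUnion K
  have htrunc : ∀ {T' : CommAlgCat.{u} R} (ψ : T ⟶ T') (x : DualAt (quasiCoherent R C) T'),
      truncate b J' x ∈
        Submodule.span T' (Set.range ((quasiCoherent R C).dual.map (φ ≫ ψ))) := by
    intro T' ψ x
    refine Submodule.sum_mem _ fun j _ => Submodule.smul_mem _ _ (Submodule.subset_span ?_)
    exact ⟨dualBasis b S j, dualBasis_map b _ j⟩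
  have hK' : ∀ {T' : CommAlgCat.{u} R} (x y : DualAt (quasiCoherent R C) T') (j : I), j ∈ J →
      coord b T' j (A.mul T' x y) = coord b T' j (A.mul T' x (truncate b J' y)) := by
    intro T' x y j hj
    refine hK j x y _ fun k hk => (coord_truncate b y ?_).symm
    exact Finset.mem_union_right _ (Finset.mem_biUnion.2 ⟨j, hj, hk⟩)
  refine ⟨⟨F, fun {T'} ψ x y => ?_, fun {T'} ψ => ?_⟩, fun x => ?_⟩
  · rw [hFcongr ψ _ (A.mul T' (truncate b J' x) (truncate b J' y)) fun j hj => by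
        rw [hK' x y j hj, hA, hK' _ x j hj, hA],
      h.map_mul_of_mem_span ψ _ (key ψ) (htrunc ψ x) (htrunc ψ y),
      hFcongr ψ x (truncate b J' x) fun j hj =>
        (coord_truncate b x (Finset.mem_union_left _ hj)).symm,
      hFcongr ψ y (truncate b J' y) fun j hj =>
        (coord_truncate b y (Finset.mem_union_left _ hj)).symm]
  · rw [← A.map_one (φ ≫ ψ), key, h.hom_one, map_one]
  · have := key (𝟙 T) x
    rwa [Category.comp_id, CommAlgCat.id_apply] at this

include b in
-- `𝓒^*(S)` lives in a larger universe by definition, but it embeds into `S^I`; the construction of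
-- universal points needs this.
lemma small_dualAt (S : CommAlgCat.{u} R) : Small.{u} (DualAt (quasiCoherent R C) S) :=
  small_of_injective (β := I → S) (f := fun x i => coord b S i x)
    fun _ _ h => dual_ext_coord b fun i => congrFun h i

include b in
-- Let `N J` be the elements whose coordinates in `J` vanish. The points vanishing on `N J` have a
-- universal member `p J`, and every point vanishes on some `N J`. A function is thus represented on
-- each piece by some `x J`, unique modulo the ideal generated by `N J`. That ideal may be larger
-- than `N J`, but its elements have zero `j`-th coordinate once `J` contains `K j`; this determines
-- each coordinate of the glued element.
lemma formal_bijective_toFunction (hA : A.IsComm) (S : CommAlgCat.{u} R) :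
    Function.Bijective (A.toFunction S) := by
  classical
  have := small_dualAt b S
  let N (J : Finset I) : Set (DualAt (quasiCoherent R C) S) :=
    {x | ∀ j ∈ J, coord b S j x = 0}
  choose T φ p hpN hpker hprep using fun J : Finset I =>
    hA.exists_universal_point (S := S) (N J)
      (fun φ p p' h => AlgebraStructure.SpecAt.ext (dual_dual_ext b φ h))
      (fun φ h hN => formal_exists_point b hA J φ h hN)
  choose K hK using exists_finset_coord_mul b A
  -- The kernel of `p J` is generated additively by products `y · n` with `n ∈ N J`, and the `j`-th
  -- coordinate of such a product is that of `y · 0` when `K j ⊆ J`.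
  have hcoord : ∀ (j : I) (J : Finset I) (x : DualAt (quasiCoherent R C) S),
      K j ⊆ J → (p J).toDual.app (𝟙 (T J)) ((quasiCoherent R C).dual.map (φ J) x) = 0 →
        coord b S j x = 0 := by
    intro j J x hj hx
    refine (AddSubgroup.closure_le (coord b S j).toAddMonoidHom.ker).2 ?_ (hpker J x hx)
    rintro _ ⟨y, n, hn, rfl⟩
    change coord b S j (A.mul S y n) = 0
    rw [hK j y n 0 fun k hk => by rw [hn k (hj hk), map_zero], map_zero, map_zero]
  refine ⟨fun x y hxy => dual_ext_coord b fun j => ?_, fun f => ?_⟩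
  · rw [← sub_eq_zero, ← map_sub]
    refine hcoord j (K j) _ subset_rfl ?_
    rw [map_sub, map_sub, sub_eq_zero]
    exact congrArg (fun f : FunctionAt A.spec S => f.app (φ (K j)) (p (K j))) hxy
  · choose x hx using fun J => hprep J f
    -- For `K j ⊆ J` the point `p (K j)` vanishes on `N J` too, so `x J` and `x (K j)` both compute
    -- the value of `f` there.
    have hcomp : ∀ (j : I) (J : Finset I), K j ⊆ J →
        coord b S j (x J) = coord b S j (x (K j)) := by
      intro j J hJ
      rw [← sub_eq_zero, ← map_sub]
      refine hcoord j (K j) _ subset_rfl ?_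
      rw [map_sub, map_sub, ← hx (K j) _ _ (hpN (K j)), ← hx J _ _ fun n hn =>
        hpN (K j) n fun k hk => hn k (hJ hk), sub_self]
    refine ⟨dualOfCoords b fun j => coord b S j (x (K j)),
      FunctionAt.ext_app fun {T'} ψ q => ?_⟩
    change A.SpecAt T' at q
    obtain ⟨J, hJ⟩ := exists_finite_support b q.toDual
    -- `J'` is large enough for `q` to vanish on `N J'` and for `x J'` to have the glued coordinates
    -- at every `j ∈ J`, the only ones that `q` sees.
    let J' : Finset I := J ∪ J.biUnion K
    have hq : ∀ {y y' : DualAt (quasiCoherent R C) S}, (∀ j ∈ J, coord b S j y = coord b S j y') →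
        q.toDual.app (𝟙 T') ((quasiCoherent R C).dual.map ψ y) =
          q.toDual.app (𝟙 T') ((quasiCoherent R C).dual.map ψ y') :=
      fun h => hJ _ _ _ fun j hj => by rw [coord_map, coord_map, h j hj]
    rw [hx J' ψ q fun n hn => by
      rw [hq (y' := 0) fun j hj => by rw [hn j (Finset.mem_union_left _ hj), map_zero],
        map_zero, map_zero], AlgebraStructure.toFunction_app]
    refine hq fun j hj => ?_
    rw [coord_dualOfCoords, hcomp j J']
    exact (Finset.subset_biUnion_of_mem K hj).trans Finset.subset_union_right

lemma quasiCoherent_dual_isFunctional [Module.Free R C] :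
    (quasiCoherent R C).dual.IsFunctional :=
  ⟨(quasiCoherent_isReflexive (Module.Free.chooseBasis R C)).dual,
    fun _ hA S => formal_bijective_toFunction (Module.Free.chooseBasis R C) hA S⟩

end Formal

/-! ### Affine monoid schemes as spectra of quasi-coherent algebras -/

/-- A presentation from an isomorphism of functors of sets. -/
def SpecPresentation.ofIso {M : ModuleFunctor.{w} R}
    {X : CommAlgCat.{u} R ⥤ Type (max w (u + 1))} {A : AlgebraStructure M} (e : X ≅ A.spec) :
    SpecPresentation X A where
  equiv S := (e.app S).toEquiv
  naturality f x := congrArg AlgebraStructure.SpecAt.toDual (NatTrans.naturality_apply e.hom f x)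

/-- The isomorphism of functors of sets defined by a presentation. -/
def SpecPresentation.toIso {M : ModuleFunctor.{w} R}
    {X : CommAlgCat.{u} R ⥤ Type (max w (u + 1))} {A : AlgebraStructure M}
    (P : SpecPresentation X A) : X ≅ A.spec :=
  NatIso.ofComponents (fun S => (P.equiv S).toIso) fun f => by
    refine ConcreteCategory.hom_ext _ _ fun x => ?_
    exact AlgebraStructure.SpecAt.ext (P.naturality f x)

section Affine

variable {A₀ : CommAlgCat.{u} R} {C : Type u} [AddCommGroup C] [Module R C] (e : A₀ ≃ₗ[R] C)
  {A : AlgebraStructure (quasiCoherent R C)}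

/-- Points of the spectrum of a quasi-coherent functor of algebras. -/
def affineEquiv
    (hmul : ∀ (S : CommAlgCat.{u} R) (x y : A₀), A.mul S ((1 : S) ⊗ₜ[R] e x)
      ((1 : S) ⊗ₜ[R] e y) = (1 : S) ⊗ₜ[R] e (x * y))
    (hone : ∀ S : CommAlgCat.{u} R, A.one S = (1 : S) ⊗ₜ[R] e 1) (S : CommAlgCat.{u} R) :
    (A₀ ⟶ S) ≃ A.SpecAt S where
  toFun g := ⟨dualOfLinearMap (g.hom.toLinearMap ∘ₗ e.symm.toLinearMap),
    fun {T} φ x y => by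
      change T ⊗[R] C at x y
      induction x with
      | zero => rw [map_zero, LinearMap.zero_apply, map_zero, zero_mul]
      | add x x' hx hx' =>
        rw [map_add, LinearMap.add_apply, map_add, map_add, add_mul, hx, hx']
      | tmul t c =>
        induction y with
        | zero => rw [map_zero, map_zero, mul_zero]
        | add y y' hy hy' => rw [map_add, map_add, map_add, mul_add, hy, hy']
        | tmul t' c' =>
          obtain ⟨x, rfl⟩ := e.surjective c
          obtain ⟨y, rfl⟩ := e.surjective c'
          -- The scalars are pulled out of the pure tensors so that `hmul`, which concerns only `1 ⊗
          -- e x`, applies.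
          rw [← mul_one t, ← mul_one t', ← smul_eq_mul, ← smul_eq_mul,
            ← TensorProduct.smul_tmul', ← TensorProduct.smul_tmul', map_smul,
            LinearMap.map_smul₂, hmul, map_smul, map_smul, map_smul, map_smul,
            dualOfLinearMap_app_tmul, dualOfLinearMap_app_tmul, dualOfLinearMap_app_tmul]
          simp
          ring,
    fun {T} φ => by
      rw [hone, dualOfLinearMap_app_tmul]
      simp⟩
  invFun p := CommAlgCat.ofHom
    { toFun := fun x => p.toDual.app (𝟙 S) ((1 : S) ⊗ₜ[R] e x)
      map_one' := by rw [← hone, p.map_one]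
      map_mul' := fun x y => by rw [← hmul, p.map_mul]
      map_zero' := by rw [map_zero, TensorProduct.tmul_zero, map_zero]
      map_add' := fun x y => by rw [map_add, TensorProduct.tmul_add, map_add]
      commutes' := fun r => by
        rw [Algebra.algebraMap_eq_smul_one, map_smul, ← TensorProduct.smul_tmul,
          ← mul_one (r • (1 : S)), ← smul_eq_mul, ← TensorProduct.smul_tmul', map_smul, ← hone,
          p.map_one, Algebra.algebraMap_eq_smul_one, smul_eq_mul, mul_one] }
  left_inv g := by
    ext x
    change (dualOfLinearMap (g.hom.toLinearMap ∘ₗ e.symm.toLinearMap)).app (𝟙 S)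
      ((1 : S) ⊗ₜ[R] e x) = g x
    rw [dualOfLinearMap_app_tmul]
    simp
  right_inv p := by
    refine AlgebraStructure.SpecAt.ext (DualAt.ext_app fun {T} φ => LinearMap.ext fun y => ?_)
    change T ⊗[R] C at y
    induction y with
    | zero => rw [map_zero, map_zero]
    | add y y' hy hy' => rw [map_add, map_add, hy, hy']
    | tmul t c =>
      rw [dualOfLinearMap_app_tmul, DualAt.app_tmul p.toDual]
      change _ * φ (p.toDual.app (𝟙 S) ((1 : S) ⊗ₜ[R] e (e.symm c))) = _
      rw [LinearEquiv.apply_symm_apply]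

/-- The functor of points of an affine scheme as the spectrum of a functor of algebras. -/
def affinePresentation
    (hmul : ∀ (S : CommAlgCat.{u} R) (x y : A₀), A.mul S ((1 : S) ⊗ₜ[R] e x)
      ((1 : S) ⊗ₜ[R] e y) = (1 : S) ⊗ₜ[R] e (x * y))
    (hone : ∀ S : CommAlgCat.{u} R, A.one S = (1 : S) ⊗ₜ[R] e 1) :
    SpecPresentation (affinePoints A₀) A where
  equiv S := Equiv.ulift.trans (affineEquiv e hmul hone S)
  naturality {S T} f g := by
    refine DualAt.ext_app fun {U} φ => LinearMap.ext fun y => ?_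
    change U ⊗[R] C at y
    induction y with
    | zero => rw [map_zero, map_zero]
    | add y y' hy hy' => rw [map_add, map_add, hy, hy']
    | tmul t c => rfl

end Affine

/-- The quasi-coherent functor of algebras `S ↦ S ⊗ A₀`. -/
def baseChangeAlgebra (A₀ : CommAlgCat.{u} R) : AlgebraStructure (quasiCoherent R A₀) where
  mul S := LinearMap.mul S (S ⊗[R] A₀)
  one S := (1 : S ⊗[R] A₀)
  mul_assoc S x y z := mul_assoc (G := S ⊗[R] A₀) x y z
  one_mul S x := one_mul (M := S ⊗[R] A₀) x
  mul_one S x := mul_one (M := S ⊗[R] A₀) x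
  map_mul f x y := map_mul (Algebra.TensorProduct.map f.hom (AlgHom.id R A₀)) x y
  map_one f := map_one (Algebra.TensorProduct.map f.hom (AlgHom.id R A₀))

lemma baseChangeAlgebra_isComm (A₀ : CommAlgCat.{u} R) : (baseChangeAlgebra A₀).IsComm :=
  fun S x y => mul_comm (G := S ⊗[R] A₀) x y

/-- Transport of a presentation along an isomorphism of functors of sets. -/
def SpecPresentation.precomp {M : ModuleFunctor.{w} R} {X Y : CommAlgCat.{u} R ⥤ Type w'}
    {A : AlgebraStructure M} (P : SpecPresentation Y A) (e : X ≅ Y) : SpecPresentation X A where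
  equiv S := (e.app S).toEquiv.trans (P.equiv S)
  naturality {S T} f x := by
    change (P.equiv T (e.hom.app T (X.map f x))).toDual = _
    rw [NatTrans.naturality_apply, P.naturality]
    rfl

/-- Two presentations over the same functor of algebras. -/
def SpecPresentation.isoOfPresentations {M : ModuleFunctor.{w} R}
    {X Y : CommAlgCat.{u} R ⥤ Type w'} {A : AlgebraStructure M} (P : SpecPresentation X A)
    (Q : SpecPresentation Y A) : X ≅ Y :=
  NatIso.ofComponents (fun S => ((P.equiv S).trans (Q.equiv S).symm).toIso) fun {S T} f => by
    refine ConcreteCategory.hom_ext _ _ fun x => ?_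
    change (Q.equiv T).symm (P.equiv T (X.map f x)) = Y.map f ((Q.equiv S).symm (P.equiv S x))
    rw [Equiv.symm_apply_eq]
    refine AlgebraStructure.SpecAt.ext ?_
    rw [P.naturality, Q.naturality, Equiv.apply_symm_apply]

lemma IsAffineMonoidScheme.exists_presentation {G : CommMonFunctor R}
    (hG : IsAffineMonoidScheme R G) :
    ∃ (C : ModuleCat.{u} R) (A : AlgebraStructure (quasiCoherent R C)),
      Module.Free R C ∧ A.IsComm ∧ Nonempty (SpecPresentation G.toSet A) := by
  obtain ⟨A₀, hfree, ⟨e⟩⟩ := hG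
  refine ⟨ModuleCat.of R A₀, baseChangeAlgebra A₀, hfree, baseChangeAlgebra_isComm A₀,
    ⟨SpecPresentation.precomp ?_ e⟩⟩
  refine affinePresentation (LinearEquiv.refl R A₀) (fun S x y => ?_) (fun S => rfl)
  change ((1 : S) ⊗ₜ[R] x) * ((1 : S) ⊗ₜ[R] y) = (1 : S) ⊗ₜ[R] (x * y)
  rw [Algebra.TensorProduct.tmul_mul_tmul, one_mul]

/-- A functor of algebras on `𝓒` is the base change of its value at `R`: its product is functorial
along `R → S`, and `S ⊗ C` is generated by the image of `R ⊗ C`. Hence its spectrum is the affine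
scheme of the ring `𝔸(R)`, a free module isomorphic to `C`. -/
lemma isAffineMonoidScheme_of_presentation {G : CommMonFunctor R} {C : Type u} [AddCommGroup C]
    [Module R C] [Module.Free R C] {A : AlgebraStructure (quasiCoherent R C)} (hA : A.IsComm)
    (P : SpecPresentation G.toSet A) : IsAffineMonoidScheme R G := by
  let R₀ := CommAlgCat.of R R
  let _ : Algebra R (hA.Carrier R₀) := (hA.structureMap R₀).toAlgebra
  let A₀ := CommAlgCat.of R (hA.Carrier R₀)
  -- The action of `R` on `A₀` through the structural morphism agrees with the module structure of
  -- `R ⊗ C`; this makes `e` linear.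
  have hsmul : ∀ (r : R) (x : R ⊗[R] C),
      (show R ⊗[R] C from ((r • (show A₀ from x) : A₀))) = r • x := fun r x =>
    hA.structureMap_mul R₀ r x
  let e : A₀ ≃ₗ[R] C :=
    { toFun := fun x => TensorProduct.lid R C x
      invFun := fun c => (TensorProduct.lid R C).symm c
      left_inv := fun x => (TensorProduct.lid R C).symm_apply_apply x
      right_inv := fun c => (TensorProduct.lid R C).apply_symm_apply c
      map_add' := fun x y => map_add (TensorProduct.lid R C) x y
      map_smul' := fun r x => (congrArg (TensorProduct.lid R C) (hsmul r x)).trans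
        ((TensorProduct.lid R C).map_smul r x) }
  have he : ∀ (S : CommAlgCat.{u} R) (x : R ⊗[R] C), (1 : S) ⊗ₜ[R] (e x) =
      (quasiCoherent R C).map (CommAlgCat.ofHom (Algebra.ofId R S) : R₀ ⟶ S) x := by
    intro S x
    change (1 : S) ⊗ₜ[R] (TensorProduct.lid R C x) = _
    induction x with
    | zero => rw [map_zero, map_zero, TensorProduct.tmul_zero]
    | add x y hx hy => rw [map_add, map_add, TensorProduct.tmul_add, hx, hy]
    | tmul r c =>
      rw [TensorProduct.lid_tmul, ← TensorProduct.smul_tmul, ← Algebra.algebraMap_eq_smul_one]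
      rfl
  refine ⟨A₀, Module.Free.of_equiv e.symm,
    ⟨P.isoOfPresentations (affinePresentation e (fun S x y => ?_) (fun S => ?_))⟩⟩
  · exact (congrArg₂ (fun a b => A.mul S a b) (he S x) (he S y)).trans
      ((A.map_mul _ _ _).symm.trans (he S _).symm)
  · rw [← A.map_one (CommAlgCat.ofHom (Algebra.ofId R S) : R₀ ⟶ S)]
    exact (he S _).symm

/-! ### The bidual of a monoid -/

section Bidual

variable {G : CommMonFunctor R}

/-- The character `χ ↦ χ(g)` of the dual monoid. -/
def evalCharacter (G : CommMonFunctor R) (S : CommAlgCat.{u} R) :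
    G.obj S →* CharacterAt (dualMonoid G) S where
  toFun g := ⟨fun {T} φ =>
      { toFun := fun (χ : CharacterAt G T) => χ.app (𝟙 T) (G.map φ g)
        map_one' := rfl
        map_mul' := fun _ _ => rfl },
    fun {T T'} φ ψ (χ : CharacterAt G T) => by
      change χ.app (ψ ≫ 𝟙 T') (G.map (φ ≫ ψ) g) = ψ (χ.app (𝟙 T) (G.map φ g))
      rw [← χ.naturality, CommMonFunctor.map_comp_apply, Category.comp_id, Category.id_comp]⟩
  map_one' := CharacterAt.ext_app fun {T} φ => MonoidHom.ext fun (χ : CharacterAt G T) => by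
    change χ.app (𝟙 T) (G.map φ 1) = 1
    rw [CommMonFunctor.map_one_apply, map_one]
  map_mul' x y := CharacterAt.ext_app fun {T} φ => MonoidHom.ext fun (χ : CharacterAt G T) => by
    change χ.app (𝟙 T) (G.map φ (x * y)) =
      χ.app (𝟙 T) (G.map φ x) * χ.app (𝟙 T) (G.map φ y)
    rw [CommMonFunctor.map_mul_apply, map_mul]

lemma evalCharacter_app {S T : CommAlgCat.{u} R} (g : G.obj S) (φ : S ⟶ T)
    (χ : CharacterAt G T) : CharacterAt.app (evalCharacter G S g) φ χ =
      DualAt.app (evalMap G.toSet S g) φ χ.toFunction := rfl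

variable {M : ModuleFunctor.{w} R} {A : AlgebraStructure M} {N : ModuleFunctor.{w'} R}

lemma SpecPresentation.isReflexive (P : SpecPresentation G.toSet A) (hA : A.IsComm)
    (hM : M.IsFunctional) : (functions G.toSet).IsReflexive :=
  (P.functionsIso (hM.2 A hA)).isReflexive hM.1

/-- `𝔾^∨` is the spectrum of `𝔸_𝔾^*` with convolution, and the chain `𝔸_𝔾^* ≅ M^* ≅ N` carries this
structure to `N`. The formula records that the resulting pairing of characters with `N` is still
evaluation. -/
lemma SpecPresentation.exists_dual (P : SpecPresentation G.toSet A) (hA : A.IsComm)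
    (hM : M.IsFunctional) (ε : M.dual.Iso N) :
    ∃ B : AlgebraStructure N, B.IsComm ∧ ∃ Q : SpecPresentation (dualMonoid G).toSet B,
      ∀ (S : CommAlgCat.{u} R) (χ : CharacterAt G S) (y : DualAt M S),
        (Q.equiv S χ).toDual.app (𝟙 S) (ε.equiv S y) =
          DualAt.app ((P.functionsIso (hM.2 A hA)).dual.equiv S y) (𝟙 S) χ.toFunction := by
  let e := P.functionsIso (hM.2 A hA)
  have h := P.isReflexive hA hM
  refine ⟨_, ((convolution_isComm h).transport e.dual.symm).transport ε,
    ((dualPresentation h).transport e.dual.symm).transport ε, fun S χ y => ?_⟩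
  change DualAt.app (e.dual.equiv S ((ε.equiv S).symm (ε.equiv S y))) (𝟙 S)
    ((functions G.toSet).map (𝟙 S) χ.toFunction) = _
  rw [LinearEquiv.symm_apply_apply, (functions G.toSet).map_id]

/-- The function on the dual monoid defined by an element of `𝔸_𝔾^*`. -/
def dualFunction {S : CommAlgCat.{u} R} (d : DualAt (functions G.toSet) S) :
    FunctionAt (dualMonoid G).toSet S where
  app {T} φ (χ : CharacterAt G T) := d.app φ χ.toFunction
  naturality φ ψ χ := d.naturality φ ψ (CharacterAt.toFunction χ)

lemma SpecPresentation.bijective_dualFunction (P : SpecPresentation G.toSet A) (hA : A.IsComm)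
    (hM : M.IsFunctional) (ε : M.dual.Iso N) (hN : N.IsFunctional) (S : CommAlgCat.{u} R) :
    Function.Bijective
      (dualFunction : DualAt (functions G.toSet) S → FunctionAt (dualMonoid G).toSet S) := by
  obtain ⟨B, hB, Q, hQ⟩ := P.exists_dual hA hM ε
  let e := P.functionsIso (hM.2 A hA)
  let e' := Q.functionsIso (hN.2 B hB)
  -- The map is the composite of the isomorphisms `𝔸_𝔾^* ≅ M^* ≅ N ≅ 𝔸_{𝔾^∨}`, the last because `N`
  -- is functional and `𝔾^∨` is its spectrum.
  have key : (dualFunction : DualAt (functions G.toSet) S → _) =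
      fun d => e'.equiv S (ε.equiv S ((e.dual.equiv S).symm d)) := by
    funext d
    refine FunctionAt.ext_app fun {T} φ (χ : CharacterAt G T) => ?_
    change d.app φ χ.toFunction = (Q.equiv T χ).toDual.app (𝟙 T)
      (N.map φ (ε.equiv S ((e.dual.equiv S).symm d)))
    rw [← ε.naturality, hQ, ← e.dual.symm_naturality]
    change _ = DualAt.app (e.dual.equiv T _) _ _
    rw [LinearEquiv.apply_symm_apply, ← DualAt.app_eq_id]
  rw [key]
  exact (e'.equiv S).bijective.comp ((ε.equiv S).bijective.comp (e.dual.equiv S).symm.bijective)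

lemma SpecPresentation.evalMap_functionsIso {X : CommAlgCat.{u} R ⥤ Type w'}
    (P : SpecPresentation X A) (h : ∀ S, Function.Bijective (A.toFunction S))
    {S T : CommAlgCat.{u} R} (x : X.obj S) (φ : S ⟶ T) (m : M.obj T) :
    DualAt.app (evalMap X S x) φ ((P.functionsIso h).equiv T m) =
      (P.equiv S x).toDual.app φ m := by
  rw [evalMap_app, P.functionsIso_app, P.naturality, ModuleFunctor.dual_map_app,
    Category.comp_id, M.map_id]

/-- A linear function on `𝔸_𝔾` that is multiplicative on characters is multiplicative. -/
lemma SpecPresentation.map_mul_of_characters (P : SpecPresentation G.toSet A) (hA : A.IsComm)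
    (h : ∀ S, Function.Bijective (A.toFunction S))
    (hinj : ∀ S : CommAlgCat.{u} R, Function.Injective
      (dualFunction : DualAt (functions G.toSet) S → FunctionAt (dualMonoid G).toSet S))
    {S : CommAlgCat.{u} R} (d : DualAt (functions G.toSet) S)
    (hd : ∀ {T : CommAlgCat.{u} R} (φ : S ⟶ T) (χ χ' : CharacterAt G T),
      d.app φ (χ * χ').toFunction = d.app φ χ.toFunction * d.app φ χ'.toFunction)
    {T : CommAlgCat.{u} R} (φ : S ⟶ T) (x y : M.obj T) :
    d.app φ ((P.functionsIso h).equiv T (A.mul T x y)) =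
      d.app φ ((P.functionsIso h).equiv T x) * d.app φ ((P.functionsIso h).equiv T y) := by
  let e := P.functionsIso h
  -- For fixed `x`, both `y ↦ d(xy)` and `y ↦ d(x)d(y)` are elements of `𝔸_𝔾^*`, which `hinj` allows
  -- to be compared on characters alone. Characters play here the role that points play in
  -- `bilinear_ext`.
  let lhs {T : CommAlgCat.{u} R} (φ : S ⟶ T) (x : M.obj T) : DualAt (functions G.toSet) T :=
    ⟨fun {U} ψ => d.app (φ ≫ ψ) ∘ₗ (e.equiv U).toLinearMap ∘ₗ A.mul U (M.map ψ x) ∘ₗ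
        (e.equiv U).symm.toLinearMap,
      fun {U V} ψ χ f => by
        change d.app (φ ≫ ψ ≫ χ) (e.equiv V (A.mul V (M.map (ψ ≫ χ) x)
          ((e.equiv V).symm ((functions G.toSet).map χ f)))) =
          χ (d.app (φ ≫ ψ) (e.equiv U (A.mul U (M.map ψ x) ((e.equiv U).symm f))))
        rw [e.symm_naturality, M.map_comp, ← A.map_mul, e.naturality, ← Category.assoc,
          d.naturality]⟩
  let rhs {T : CommAlgCat.{u} R} (φ : S ⟶ T) (x : M.obj T) : DualAt (functions G.toSet) T :=
    ⟨fun {U} ψ => d.app (φ ≫ ψ) (e.equiv U (M.map ψ x)) • d.app (φ ≫ ψ),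
      fun {U V} ψ χ f => by
        rw [LinearMap.smul_apply, LinearMap.smul_apply, smul_eq_mul, smul_eq_mul, map_mul,
          ← d.naturality, ← d.naturality, M.map_comp, e.naturality, Category.assoc]⟩
  have hlhs : ∀ {T U : CommAlgCat.{u} R} (φ : S ⟶ T) (x : M.obj T) (ψ : T ⟶ U)
      (f : FunctionAt G.toSet U), (lhs φ x).app ψ f =
        d.app (φ ≫ ψ) (e.equiv U (A.mul U (M.map ψ x) ((e.equiv U).symm f))) :=
    fun _ _ _ _ => rfl
  have hrhs : ∀ {T U : CommAlgCat.{u} R} (φ : S ⟶ T) (x : M.obj T) (ψ : T ⟶ U)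
      (f : FunctionAt G.toSet U), (rhs φ x).app ψ f =
        d.app (φ ≫ ψ) (e.equiv U (M.map ψ x)) * d.app (φ ≫ ψ) f :=
    fun _ _ _ _ => rfl
  have hmul : ∀ {T : CommAlgCat.{u} R} (χ χ' : CharacterAt G T),
      e.equiv T (A.mul T ((e.equiv T).symm χ.toFunction) ((e.equiv T).symm χ'.toFunction)) =
        (χ * χ').toFunction := by
    intro T χ χ'
    obtain ⟨x, hx⟩ := (e.equiv T).surjective χ.toFunction
    obtain ⟨y, hy⟩ := (e.equiv T).surjective χ'.toFunction
    refine FunctionAt.ext_app fun {U} ψ g => ?_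
    have : (χ * χ').toFunction.app ψ g = χ.toFunction.app ψ g * χ'.toFunction.app ψ g := rfl
    rw [this, ← hx, ← hy, LinearEquiv.symm_apply_apply, LinearEquiv.symm_apply_apply,
      P.functionsIso_app, P.functionsIso_app, P.functionsIso_app, A.map_mul,
      AlgebraStructure.SpecAt.map_mul]
  have hchar : ∀ {T : CommAlgCat.{u} R} (φ : S ⟶ T) (χ : CharacterAt G T),
      lhs φ ((e.equiv T).symm χ.toFunction) = rhs φ ((e.equiv T).symm χ.toFunction) := by
    intro T φ χ
    refine hinj T (FunctionAt.ext_app fun {U} ψ (χ' : CharacterAt G U) => ?_)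
    change (lhs φ _).app ψ χ'.toFunction = (rhs φ _).app ψ χ'.toFunction
    rw [hlhs, hrhs, ← e.symm_naturality, LinearEquiv.apply_symm_apply,
      ← CharacterAt.toFunction_restrict, hmul, hd]
  -- `hchar` settles the case where the first factor is a character and the second is arbitrary;
  -- commutativity of `A` exchanges the factors.
  have hall : lhs φ x = rhs φ x := by
    refine hinj T (FunctionAt.ext_app fun {U} ψ (χ : CharacterAt G U) => ?_)
    change (lhs φ _).app ψ χ.toFunction = (rhs φ _).app ψ χ.toFunction
    have := congrArg (fun D : DualAt (functions G.toSet) U =>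
      D.app (𝟙 U) (e.equiv U (M.map ψ x))) (hchar (φ ≫ ψ) χ)
    change (lhs (φ ≫ ψ) _).app (𝟙 U) _ = (rhs (φ ≫ ψ) _).app (𝟙 U) _ at this
    rw [hlhs, hrhs, Category.comp_id, M.map_id, LinearEquiv.symm_apply_apply,
      LinearEquiv.apply_symm_apply] at this
    rw [hlhs, hrhs, hA, this, mul_comm]
  have := congrArg (fun D : DualAt (functions G.toSet) T => D.app (𝟙 T) (e.equiv T y)) hall
  change (lhs φ x).app (𝟙 T) _ = (rhs φ x).app (𝟙 T) _ at this
  rwa [hlhs, hrhs, Category.comp_id, M.map_id, LinearEquiv.symm_apply_apply] at this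

/-- Both halves use that `𝔸_𝔾^*` is the functor of functions on `𝔾^∨`. Points with the same values
on characters define the same element of `𝔸_𝔾^*`, hence coincide. A character of `𝔾^∨` is a function
on `𝔾^∨`, so it comes from an element of `𝔸_𝔾^*`; this element is multiplicative on characters,
hence on `𝔸_𝔾`, and is a point of `Spec 𝔸_𝔾 = 𝔾`. -/
theorem SpecPresentation.bijective_evalCharacter (P : SpecPresentation G.toSet A)
    (hA : A.IsComm) (hM : M.IsFunctional) (ε : M.dual.Iso N) (hN : N.IsFunctional)
    (S : CommAlgCat.{u} R) : Function.Bijective (evalCharacter G S) := by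
  have hδ := fun S => P.bijective_dualFunction hA hM ε hN S
  let e := P.functionsIso (hM.2 A hA)
  refine ⟨fun g g' hg => ?_, fun θ => ?_⟩
  · have h₁ : evalMap G.toSet S g = evalMap G.toSet S g' := by
      refine (hδ S).1 (FunctionAt.ext_app fun {T} φ (χ : CharacterAt G T) => ?_)
      exact congrArg (fun θ : CharacterAt (dualMonoid G) S => θ.app φ χ) hg
    refine (P.equiv S).injective (AlgebraStructure.SpecAt.ext (DualAt.ext_app fun {T} φ =>
      LinearMap.ext fun m => ?_))
    rw [← P.evalMap_functionsIso (hM.2 A hA), ← P.evalMap_functionsIso (hM.2 A hA)]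
    exact congrArg (fun d : DualAt (functions G.toSet) S => d.app φ _) h₁
  · obtain ⟨d, hd⟩ := (hδ S).2 θ.toFunction
    have hd' : ∀ {T : CommAlgCat.{u} R} (φ : S ⟶ T) (χ : CharacterAt G T),
        d.app φ χ.toFunction = θ.app φ χ := fun φ χ =>
      congrArg (fun f : FunctionAt (dualMonoid G).toSet S => f.app φ χ) hd
    let p : A.SpecAt S := ⟨(e.dual.equiv S).symm d, fun {T} φ x y => by
        rw [e.dual_equiv_symm_app, e.dual_equiv_symm_app, e.dual_equiv_symm_app]
        refine P.map_mul_of_characters hA (hM.2 A hA) (fun S => (hδ S).1) d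
          (fun {T} φ χ χ' => ?_) φ x y
        rw [hd', hd', hd']
        exact map_mul (θ.app φ) χ χ',
      fun {T} φ => by
        rw [e.dual_equiv_symm_app]
        have h1 : e.equiv T (A.one T) = (1 : CharacterAt G T).toFunction := by
          refine FunctionAt.ext_app fun {U} ψ g => ?_
          rw [P.functionsIso_app, A.map_one, AlgebraStructure.SpecAt.map_one]
          rfl
        rw [h1, hd']
        exact map_one (θ.app φ)⟩
    refine ⟨(P.equiv S).symm p, CharacterAt.ext_app fun {T} φ =>
      MonoidHom.ext fun (χ : CharacterAt G T) => ?_⟩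
    rw [evalCharacter_app]
    obtain ⟨m, hm⟩ := (e.equiv T).surjective χ.toFunction
    rw [← hd', ← hm, P.evalMap_functionsIso, Equiv.apply_symm_apply]
    rfl

end Bidual

/-! ### Anti-equivalences -/

section Equivalence

/-- The natural morphism from a functor of monoids to its bidual. -/
def bidualHom (G : CommMonFunctor R) : G ⟶ dualMonoid (dualMonoid G) where
  app S := CommMonCat.ofHom (evalCharacter G S)
  naturality {S T} f := by
    refine CommMonCat.hom_ext (MonoidHom.ext fun (g : G.obj S) => ?_)
    refine CharacterAt.ext_app fun {U} φ => MonoidHom.ext fun (χ : CharacterAt G U) => ?_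
    change χ.app (𝟙 U) (G.map φ (G.map f g)) = χ.app (𝟙 U) (G.map (f ≫ φ) g)
    rw [CommMonFunctor.map_comp_apply]

lemma bidualHom_naturality {G H : CommMonFunctor R} (h : G ⟶ H) :
    h ≫ bidualHom H = bidualHom G ≫
      (dualMonoidFunctor R).map ((dualMonoidFunctor R).map h.op).op := by
  ext S g
  refine CharacterAt.ext_app fun {U} φ => MonoidHom.ext fun (χ : CharacterAt H U) => ?_
  change χ.app (𝟙 U) (H.map φ (h.app S g)) = χ.app (𝟙 U) (h.app U (G.map φ g))
  rw [NatTrans.naturality_apply]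

lemma isIso_bidualHom {G : CommMonFunctor R}
    (h : ∀ S, Function.Bijective (evalCharacter G S)) : IsIso (bidualHom G) := by
  have : ∀ S, IsIso ((bidualHom G).app S) := fun S =>
    (ConcreteCategory.isIso_iff_bijective _).2 (h S)
  exact NatIso.isIso_of_isIso_app _

/-- Duality is an anti-equivalence between two classes of functors of monoids that it
interchanges and whose members are isomorphic to their biduals. -/
lemma isEquivalence_dual {P Q : ObjectProperty (CommMonFunctor R)}
    (hPQ : ∀ G : P.FullSubcategoryᵒᵖ, Q ((P.ι.op ⋙ dualMonoidFunctor R).obj G))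
    (hQP : ∀ G, Q G → P (dualMonoid G))
    (hP : ∀ G, P G → IsIso (bidualHom G)) (hQ : ∀ G, Q G → IsIso (bidualHom G)) :
    (Q.lift (P.ι.op ⋙ dualMonoidFunctor R) hPQ).IsEquivalence := by
  -- By naturality of `bidualHom`, the bidual of `h`, and so already its dual, determines `h ≫
  -- bidualHom H`.
  have inj : ∀ {G H : CommMonFunctor R}, IsIso (bidualHom H) → ∀ {h k : G ⟶ H},
      (dualMonoidFunctor R).map h.op = (dualMonoidFunctor R).map k.op → h = k := by
    intro G H _ h k hhk
    rw [← cancel_mono (bidualHom H), bidualHom_naturality, bidualHom_naturality, hhk]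
  have full : ∀ {G H : CommMonFunctor R}, IsIso (bidualHom G) → IsIso (bidualHom H) →
      IsIso (bidualHom (dualMonoid G)) → ∀ k : dualMonoid H ⟶ dualMonoid G,
      ∃ h : G ⟶ H, (dualMonoidFunctor R).map h.op = k := by
    intro G H _ _ hG k
    let k' : dualMonoid (dualMonoid G) ⟶ dualMonoid (dualMonoid H) :=
      (dualMonoidFunctor R).map k.op
    -- The preimage of `k` is `k^∨` read through the bidual isomorphisms. Its dual is compared with
    -- `k` after dualizing once more, which loses nothing because `bidualHom (dualMonoid G)` is
    -- invertible.
    refine ⟨bidualHom G ≫ k' ≫ inv (bidualHom H), inj hG ?_⟩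
    refine (cancel_epi (bidualHom G)).1 ?_
    exact (bidualHom_naturality _).symm.trans (by
      rw [Category.assoc, Category.assoc, IsIso.inv_hom_id, Category.comp_id]
      rfl)
  have hfaithful : (Q.lift (P.ι.op ⋙ dualMonoidFunctor R) hPQ).Faithful :=
    ⟨fun {G H h k} hhk => by
      have := congrArg (fun f => Q.ι.map f) hhk
      exact Quiver.Hom.unop_inj (P.ι.map_injective (inj (hP _ G.unop.property) this))⟩
  have hfull : (Q.lift (P.ι.op ⋙ dualMonoidFunctor R) hPQ).Full :=
    ⟨fun {G H} k => by
      obtain ⟨h, hh⟩ := full (hP _ H.unop.property) (hP _ G.unop.property)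
        (hQ _ (hPQ H)) (Q.ι.map k)
      refine ⟨(P.ι.preimage h).op, Q.ι.map_injective ?_⟩
      change (dualMonoidFunctor R).map (P.ι.map (P.ι.preimage h)).op = _
      rw [P.ι.map_preimage, hh]⟩
  have hsurj : (Q.lift (P.ι.op ⋙ dualMonoidFunctor R) hPQ).EssSurj :=
    ⟨fun H => by
      have := hQ _ H.property
      exact ⟨op ⟨dualMonoid H.obj, hQP _ H.property⟩,
        ⟨Q.ι.preimageIso (asIso (bidualHom H.obj)).symm⟩⟩⟩
  exact { faithful := hfaithful, full := hfull, essSurj := hsurj }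

end Equivalence

/-! ### Affine monoid schemes and formal monoids -/

lemma IsFormalMonoid.exists_presentation {G : CommMonFunctor R} (hG : IsFormalMonoid R G) :
    ∃ (C : ModuleCat.{u} R) (A : AlgebraStructure (quasiCoherent R C).dual),
      Module.Free R C ∧ A.IsComm ∧ Nonempty (SpecPresentation G.toSet A) := by
  obtain ⟨C, A, hC, hA, ⟨e⟩⟩ := hG
  exact ⟨C, A, hC, hA, ⟨SpecPresentation.ofIso e⟩⟩

/-- The identity of a functor of modules. -/
def ModuleFunctor.Iso.refl (M : ModuleFunctor.{w} R) : M.Iso M where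
  equiv S := LinearEquiv.refl S (M.obj S)
  naturality _ _ := rfl

lemma IsAffineMonoidScheme.dual {G : CommMonFunctor R} (hG : IsAffineMonoidScheme R G) :
    IsFormalMonoid R (dualMonoid G) := by
  obtain ⟨C, A, hC, hA, ⟨P⟩⟩ := hG.exists_presentation
  obtain ⟨B, hB, Q, -⟩ := P.exists_dual hA quasiCoherent_isFunctional
    (ModuleFunctor.Iso.refl _)
  exact ⟨C, B, hC, hB, ⟨Q.toIso⟩⟩

/-- Here `M` is `𝓒^*` and `N` is `𝓒`; reflexivity of `𝓒` supplies the isomorphism `M^* = 𝓒^{**} ≅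
𝓒`, whereas in the affine case `M^*` is `𝓒^*` on the nose. -/
lemma IsFormalMonoid.dual {G : CommMonFunctor R} (hG : IsFormalMonoid R G) :
    IsAffineMonoidScheme R (dualMonoid G) := by
  obtain ⟨C, A, hC, hA, ⟨P⟩⟩ := hG.exists_presentation
  obtain ⟨B, hB, Q, -⟩ := P.exists_dual hA quasiCoherent_dual_isFunctional
    (quasiCoherent_isFunctional (R := R) (C := C)).1.iso.symm
  exact isAffineMonoidScheme_of_presentation hB Q

lemma IsAffineMonoidScheme.isReflexive {G : CommMonFunctor R}
    (hG : IsAffineMonoidScheme R G) : (functions G.toSet).IsReflexive := by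
  obtain ⟨C, A, hC, hA, ⟨P⟩⟩ := hG.exists_presentation
  exact P.isReflexive hA quasiCoherent_isFunctional

lemma IsFormalMonoid.isReflexive {G : CommMonFunctor R}
    (hG : IsFormalMonoid R G) : (functions G.toSet).IsReflexive := by
  obtain ⟨C, A, hC, hA, ⟨P⟩⟩ := hG.exists_presentation
  exact P.isReflexive hA quasiCoherent_dual_isFunctional

lemma IsAffineMonoidScheme.isIso_bidualHom {G : CommMonFunctor R}
    (hG : IsAffineMonoidScheme R G) : IsIso (bidualHom G) := by
  obtain ⟨C, A, hC, hA, ⟨P⟩⟩ := hG.exists_presentation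
  exact CartierDuality.isIso_bidualHom (P.bijective_evalCharacter hA quasiCoherent_isFunctional
    (ModuleFunctor.Iso.refl _) quasiCoherent_dual_isFunctional)

lemma IsFormalMonoid.isIso_bidualHom {G : CommMonFunctor R}
    (hG : IsFormalMonoid R G) : IsIso (bidualHom G) := by
  obtain ⟨C, A, hC, hA, ⟨P⟩⟩ := hG.exists_presentation
  exact CartierDuality.isIso_bidualHom (P.bijective_evalCharacter hA
    quasiCoherent_dual_isFunctional
    (quasiCoherent_isFunctional (R := R) (C := C)).1.iso.symm quasiCoherent_isFunctional)

end CartierDuality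

end

theorem mainTheorem12 (R : Type u) [CommRing R] :
    (∃ (h₁ : ∀ G : (IsAffineMonoidScheme R).FullSubcategoryᵒᵖ,
          IsFormalMonoid R (((IsAffineMonoidScheme R).ι.op ⋙ dualMonoidFunctor R).obj G))
        (h₂ : ∀ G : (IsFormalMonoid R).FullSubcategoryᵒᵖ,
          IsAffineMonoidScheme R (((IsFormalMonoid R).ι.op ⋙ dualMonoidFunctor R).obj G)),
        ((IsFormalMonoid R).lift
          ((IsAffineMonoidScheme R).ι.op ⋙ dualMonoidFunctor R) h₁).IsEquivalence ∧
        ((IsAffineMonoidScheme R).lift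
          ((IsFormalMonoid R).ι.op ⋙ dualMonoidFunctor R) h₂).IsEquivalence) ∧
    (∀ G : CommMonFunctor R, IsAffineMonoidScheme R G ∨ IsFormalMonoid R G →
      (functions G.toSet).IsReflexive) ∧
    (∀ G : CommMonFunctor R, (functions G.toSet).IsReflexive →
      ∃ A : AlgebraStructure (functions G.toSet).dual,
        ExtendsMonoid G A ∧ (∀ A', ExtendsMonoid G A' → A' = A) ∧ A.IsComm ∧
        ∃ e : A.spec ≅ (dualMonoid G).toSet,
          ∀ (S : CommAlgCat.{u} R) (p : A.SpecAt S) (T : CommAlgCat.{u} R) (φ : S ⟶ T)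
            (g : G.obj T),
            CharacterAt.app (e.hom.app S p) φ g = p.toDual.app φ (evalMap G.toSet T g)) := by
  refine ⟨⟨fun G => G.unop.property.dual, fun G => G.unop.property.dual,
    isEquivalence_dual _ (fun _ h => h.dual) (fun _ h => h.isIso_bidualHom)
      (fun _ h => h.isIso_bidualHom),
    isEquivalence_dual _ (fun _ h => h.dual) (fun _ h => h.isIso_bidualHom)
      (fun _ h => h.isIso_bidualHom)⟩,
    fun G hG => hG.elim (fun h => h.isReflexive) (fun h => h.isReflexive), fun G hG => ?_⟩
  exact ⟨convolution G, extendsMonoid_convolution G, fun A' h => h.eq_convolution hG,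
    convolution_isComm hG, specConvolutionIso hG,
    fun S p T φ g => specConvolutionIso_hom_app hG p φ g⟩
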